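/- Let $n,d\ge 1$, let $\mathrm D=-\mathrm i\partial$, and consider the Cauchy problem $$\mathrm D_tU=\sum_{k=1}^nA_k(t)\,\mathrm D_{x_k}U+\mathrm iB(t)U,\quad t\ge 0,\qquad U(0,\cdot)=U_0,$$ for $U(t,x)\in\mathbb C^d$, $x\in\mathbb R^n$. The coefficients $A_k,B:[0,\infty)\to\mathbb C^{d\times d}$ are smooth and satisfy, for every $\ell\ge 0$, $$\|\partial_t^\ell A_k(t)\|+\|\partial_t^\ell B(t)\|\le C_\ell(1+t)^{-\ell}\qquad (t\ge 0).$$ Put $A(t,\xi)=\sum_{k=1}^n\xi_kA_k(t)$ and assume: (B1) the matrices $A_k(t)$ are self-adjoint and $B(t)\ge 0$ (self-adjoint, positive semidefinite) for all $t\ge 0$; (B2) for all $t\ge0$ the matrix $B(t)$ has $d$ eigenvalues $0=\delta_1(t)<\delta_2(t)<\dots<\delta_d(t)$, and $\liminf_{t\to\infty}|\delta_i(t)-\delta_j(t)|>0$ for $i\ne j$; (B3) for every choice of $\epsilon_0,\dots,\epsilon_{d-1}>0$ there are $c>0$ and $t_0\ge0$ such that $$\frac1c\|v\|^2\le\sum_{j=0}^{d-1}\epsilon_j\,\|B(t)A(t,\xi)^jv\|^2\le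 c\,\|v\|^2\qquad\text{for all }t\ge t_0,\ |\xi|=1,\ v\in\mathbb C^d.$$ Let $1\le p\le 2\le q\le\infty$ and $r\ge n\left(\frac1p-\frac1q\right)$, where in the case $p=1$ or $q=\infty$ the strict inequality $r>n\left(\frac1p-\frac1q\right)$ is required. Let $L^p_r(\mathbb R^n)=\langle\mathrm D_x\rangle^{-r}L^p(\mathbb R^n)$ be the Bessel potential space, with $\langle\mathrm D_x\rangle=(1-\Delta)^{1/2}$ and $\|u\|_{L^p_r}=\|\langle\mathrm D_x\rangle^ru\|_{L^p}$. Then there is a constant $C>0$, depending only on $n,d,p,q,r$ and the coefficients $A_k,B$, such that for all $U_0\in L^p_r(\mathbb R^n;\mathbb C^d)$ and all solutions $U\in C([0,\infty);L^2(\mathbb R^n;\mathbb C^d))$ of the Cauchy problem (in the sense of tempered distributions in $x$, for every $t\ge 0$) $$\|U(t,\cdot)\|_{L^q}\le C(1+t)^{-\frac n2\left(\frac1p-\frac1q\right)}\|U_0\|_{L^p_r}\qquad\text{for all }t\ge 0.$$ -/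

import Mathlib

open MeasureTheory TemperedDistribution Filter Set
open scoped ENNReal SchwartzMap LineDeriv ContDiff ComplexOrder

noncomputable section

namespace PartDiss

/-- The space variable `x ∈ ℝⁿ`, with its Euclidean norm. -/
abbrev Rn (n : ℕ) : Type := EuclideanSpace ℝ (Fin n)

/-- The state space `ℂᵈ`, with its Euclidean norm. -/
abbrev Cd (d : ℕ) : Type := EuclideanSpace ℂ (Fin d)

/-! ### Bessel potential spaces -/

/-- The symbol of `⟨D_x⟩ ^ r`, where `D = -i∂`. Mathlib's Fourier transform has kernel
`exp (-2πi x·ξ)`, so that `D_x` has the symbol `2πξ`. -/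
def japaneseSymbol {n : ℕ} (r : ℝ) (ξ : Rn n) : ℂ :=
  (((1 + (2 * Real.pi * ‖ξ‖) ^ 2) ^ (r / 2) : ℝ) : ℂ)

/-- The symbol has temperate growth, so that the Fourier multiplier below is not a junk value. -/
theorem japaneseSymbol_hasTemperateGrowth {n : ℕ} (r : ℝ) :
    (japaneseSymbol (n := n) r).HasTemperateGrowth := by
  have h := (Function.hasTemperateGrowth_one_add_norm_sq_rpow (Rn n) (r / 2)).comp
    (((2 * Real.pi) • ContinuousLinearMap.id ℝ (Rn n)).hasTemperateGrowth)
  have h2 := (Complex.ofRealCLM.hasTemperateGrowth).comp h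
  convert h2 using 1
  ext ξ
  simp [japaneseSymbol, norm_smul, abs_of_pos Real.pi_pos]

/-- The operator `⟨D_x⟩ ^ r = (1 - Δ) ^ (r / 2)` on `ℂᵈ`-valued tempered distributions. -/
def japaneseOp (n d : ℕ) (r : ℝ) : 𝓢'(Rn n, Cd d) →L[ℂ] 𝓢'(Rn n, Cd d) :=
  fourierMultiplierCLM (Cd d) (japaneseSymbol r)

/-- `u ∈ L^p_r = ⟨D_x⟩ ^ (-r) L^p`. -/
def MemLpr {n d : ℕ} (p : ℝ≥0∞) [Fact (1 ≤ p)] (r : ℝ) (u : 𝓢'(Rn n, Cd d)) : Prop :=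
  ∃ g : Lp (Cd d) p (volume : Measure (Rn n)), japaneseOp n d r u = g

/-- The norm `‖⟨D_x⟩ ^ r u‖_{L^p}` of `L^p_r`; the infimum runs over at most one `g`
and is `∞` when `u ∉ L^p_r`. -/
def lprNorm {n d : ℕ} (p : ℝ≥0∞) [Fact (1 ≤ p)] (r : ℝ) (u : 𝓢'(Rn n, Cd d)) : ℝ≥0∞ :=
  ⨅ (g : Lp (Cd d) p (volume : Measure (Rn n))) (_ : japaneseOp n d r u = g), ‖g‖ₑ

theorem lprNorm_eq {n d : ℕ} (p : ℝ≥0∞) [Fact (1 ≤ p)] (r : ℝ) (u : 𝓢'(Rn n, Cd d))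
    (g : Lp (Cd d) p (volume : Measure (Rn n))) (hg : japaneseOp n d r u = g) :
    lprNorm p r u = ‖g‖ₑ := by
  apply le_antisymm
  · exact iInf₂_le g hg
  · refine le_iInf₂ fun g' hg' => ?_
    have hinj := LinearMap.ker_eq_bot.1
      (Lp.ker_toTemperedDistributionCLM_eq_bot (F := Cd d) (p := p) (μ := (volume : Measure (Rn n))))
    have : g = g' := hinj (by simpa using hg.symm.trans hg')
    rw [this]

/-! ### Coefficients -/

/-- The class `𝒯{ℓ}` of smooth functions on `[0, ∞)` whose `k`-th derivative is
`O((1 + t) ^ (-ℓ - k))` for every `k`. -/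
def TClass (l : ℕ) (f : ℝ → ℂ) : Prop :=
  ContDiffOn ℝ ∞ f (Ici 0) ∧
    ∀ k : ℕ, ∃ C : ℝ, ∀ t : ℝ, 0 ≤ t →
      ‖iteratedDerivWithin k f (Ici 0) t‖ ≤ C * (1 / (1 + t)) ^ (l + k)

/-- Matrix-valued functions with all entries in `𝒯{ℓ}`. -/
def MatTClass {d : ℕ} (l : ℕ) (M : ℝ → Matrix (Fin d) (Fin d) ℂ) : Prop :=
  ∀ i j, TClass l fun t => M t i j

/-- `A(t, ξ) = ∑ₖ ξₖ Aₖ(t)`. -/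
def symbolA {n d : ℕ} (A : Fin n → ℝ → Matrix (Fin d) (Fin d) ℂ) (t : ℝ) (ξ : Rn n) :
    Matrix (Fin d) (Fin d) ℂ :=
  ∑ k, (ξ k : ℂ) • A k t

/-- (B1): the `Aₖ(t)` are self-adjoint and `B(t) ≥ 0` (in particular `B(t)` is self-adjoint). -/
def CondB1 {n d : ℕ} (A : Fin n → ℝ → Matrix (Fin d) (Fin d) ℂ)
    (B : ℝ → Matrix (Fin d) (Fin d) ℂ) : Prop :=
  ∀ t : ℝ, 0 ≤ t → (∀ k, (A k t).IsHermitian) ∧ (B t).PosSemidef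

/-- (B2): `B(t)` has `d` eigenvalues `0 = δ₁(t) < ⋯ < δ_d(t)` whose mutual distances have a
positive lower limit as `t → ∞`. -/
def CondB2 {d : ℕ} [NeZero d] (B : ℝ → Matrix (Fin d) (Fin d) ℂ) : Prop :=
  ∃ δ : Fin d → ℝ → ℝ,
    (∀ t : ℝ, 0 ≤ t →
      δ 0 t = 0 ∧ (StrictMono fun i => δ i t) ∧
        ∀ i, Module.End.HasEigenvalue (Matrix.toEuclideanLin (B t)) (δ i t : ℂ)) ∧
    ∀ i j, i ≠ j → 0 < liminf (fun t => |δ i t - δ j t|) atTop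

/-- (B3): the uniform Kalman rank condition, for `ξ` in the unit sphere. -/
def CondB3 {n d : ℕ} (A : Fin n → ℝ → Matrix (Fin d) (Fin d) ℂ)
    (B : ℝ → Matrix (Fin d) (Fin d) ℂ) : Prop :=
  ∀ ε : Fin d → ℝ, (∀ j, 0 < ε j) →
    ∃ c : ℝ, 0 < c ∧ ∃ t₀ : ℝ, 0 ≤ t₀ ∧
      ∀ t : ℝ, t₀ ≤ t → ∀ ξ : Rn n, ‖ξ‖ = 1 → ∀ v : Cd d,
        1 / c * ‖v‖ ^ 2 ≤
            ∑ j : Fin d, ε j * ‖Matrix.toEuclideanLin (B t * symbolA A t ξ ^ (j : ℕ)) v‖ ^ 2 ∧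
          ∑ j : Fin d, ε j * ‖Matrix.toEuclideanLin (B t * symbolA A t ξ ^ (j : ℕ)) v‖ ^ 2 ≤
            c * ‖v‖ ^ 2

/-! ### The Cauchy problem -/

/-- `U ∈ C([0, ∞); L²(ℝⁿ; ℂᵈ))` solves the Cauchy problem
`D_t U = ∑ₖ Aₖ(t) D_{xₖ} U + i B(t) U`, `U(0) = U₀`, where `D = -i∂`. The equation is understood
in the sense of tempered distributions in `x`, for each `t ≥ 0`: tested with `φ ∈ 𝓢`, it reads
`∂ₜ ⟨U(t), φ⟩ = i (∑ₖ Aₖ(t) (-i) ⟨∂ₖ U(t), φ⟩ + i B(t) ⟨U(t), φ⟩)`. -/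
structure IsSolution {n d : ℕ} (A : Fin n → ℝ → Matrix (Fin d) (Fin d) ℂ)
    (B : ℝ → Matrix (Fin d) (Fin d) ℂ) (U₀ : 𝓢'(Rn n, Cd d))
    (U : ℝ → Lp (Cd d) 2 (volume : Measure (Rn n))) : Prop where
  continuousOn : ContinuousOn U (Ici 0)
  initial : (U 0 : 𝓢'(Rn n, Cd d)) = U₀
  equation : ∀ φ : 𝓢(Rn n, ℂ), ∀ t : ℝ, 0 ≤ t →
    HasDerivWithinAt (fun s : ℝ => (U s : 𝓢'(Rn n, Cd d)) φ)
      (Complex.I •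
        ((∑ k, Matrix.toEuclideanLin (A k t)
            ((-Complex.I) •
              (∂_{EuclideanSpace.single k (1 : ℝ)} (U t : 𝓢'(Rn n, Cd d)) : 𝓢'(Rn n, Cd d)) φ))
          + Complex.I • Matrix.toEuclideanLin (B t) ((U t : 𝓢'(Rn n, Cd d)) φ)))
      (Ici 0) t

end PartDiss

end

namespace PartDiss

/-! ### The Sobolev inequality for isometries of `L²` that map `L¹` to `L^∞` -/

/-! On the Fourier side the system is `∂ₜV = (2πi A(t,ξ) - B(t))V`, and two facts suffice: a
pointwise decay bound for `V` and a scaled Sobolev embedding.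

Decay (`exists_ae_norm_sq_fourier_le`): `|V(t,ξ)|² ≤ C exp(-γ t |ξ|²/(1+|ξ|²)) |V(0,ξ)|²`. The
energy identity dissipates only `BV`. Adding to `‖V‖²` small multiples of `Im⟨BAʲV, BAʲ⁺¹V⟩`
produces the missing terms `-‖BAʲ⁺¹V‖²`, and the Kalman condition makes their sum control `‖V‖²`.
Log-concave weights let the dissipation absorb the cross terms (`exists_hypocoercive_weights`). The
time derivatives of the coefficients cost `O(1/(1+t))`, which is absorbed once `t ≳ 1/ρ` at
frequency scale `ρ`; the rate is at most of order `ρ`, so waiting that long costs only a constant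
factor (`DissipativeFamily.exists_decay`).

As a solution is only an `L²`-valued weak one, this argument is run in the Hilbert space `L²` of an
annulus `σ < |ξ| < 2σ`, where multiplication by `A(t, ξ/σ)` is bounded uniformly in `σ` and the weak
equation becomes a strong one. The constants do not depend on the Hilbert space, so cutting off to
arbitrary measurable sets recovers the bound at almost every `ξ`.

Embedding: with `T = 1 + t` and weights in `1 + T|ξ|²`, the inverse Fourier transform maps weighted
`L²` to `L^q` (`exists_eLpNorm_le_weighted`), and dually the Fourier transform maps `L^p` to
weighted `L²` (`exists_smulLeftCLM_fourier_eq`). By scaling, each step gains its share of the power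
of `T`. The two facts fit together because `1 + (1+t)|ξ|² = (1+|ξ|²)(1 + t|ξ|²/(1+|ξ|²))`: the
exponential absorbs the second factor, and the first costs exactly `r` derivatives. No separation of
low and high frequencies is needed. -/

theorem exists_setLIntegral_ball_norm_rpow {n : ℕ} (hn : 0 < n) {a : ℝ} (ha : a < n) :
    ∃ c : ℝ, 0 < c ∧ ∀ R : ℝ, 0 < R →
      ∫⁻ ξ in Metric.ball (0 : Rn n) R, ENNReal.ofReal (‖ξ‖ ^ (-a)) =
        ENNReal.ofReal (c * R ^ (n - a)) := by
  have : Nonempty (Fin n) := ⟨⟨0, hn⟩⟩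
  have hna : 0 < n - a := by linarith
  have hfin : Module.finrank ℝ (Rn n) = n := by simp
  have hV : 0 < (volume : Measure (Rn n)).real (Metric.ball 0 1) :=
    ENNReal.toReal_pos (Metric.measure_ball_pos _ _ one_pos).ne' measure_ball_lt_top.ne
  refine ⟨n * (volume : Measure (Rn n)).real (Metric.ball 0 1) / (n - a), by positivity, ?_⟩
  intro R hR
  have hI : IntegrableOn (fun ξ : Rn n => ‖ξ‖ ^ (-a)) (Metric.ball 0 R) := by
    refine integrableOn_ball_of_norm_le_rpow (C := 1) (α := a) ?_ ?_ ?_ ?_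
    · rw [hfin]; exact hn
    · rw [hfin]; exact ha
    · refine Eventually.of_forall fun ξ => ?_
      rw [one_mul, Real.norm_of_nonneg (by positivity)]
    · exact (by fun_prop : Measurable fun ξ : Rn n => ‖ξ‖ ^ (-a)).aestronglyMeasurable
  rw [← ofReal_integral_eq_lintegral_ofReal hI (Eventually.of_forall fun ξ => by positivity)]
  congr 1
  rw [← integral_indicator measurableSet_ball]
  have h1 : (Metric.ball (0 : Rn n) R).indicator (fun ξ => ‖ξ‖ ^ (-a)) =
      fun ξ => (Iio R).indicator (fun y : ℝ => y ^ (-a)) ‖ξ‖ := by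
    ext ξ
    simp [indicator]
  rw [h1, integral_fun_norm_addHaar, hfin]
  have h2 : ∫ y in Ioi (0 : ℝ), y ^ (n - 1) • (Iio R).indicator (fun y : ℝ => y ^ (-a)) y =
      R ^ (n - a) / (n - a) := by
    have h3 : ∫ y in Ioi (0 : ℝ), y ^ (n - 1) • (Iio R).indicator (fun y : ℝ => y ^ (-a)) y =
        ∫ y in Ioi (0 : ℝ), (Iio R).indicator (fun y : ℝ => y ^ ((n : ℝ) - a - 1)) y := by
      refine setIntegral_congr_fun measurableSet_Ioi fun y hy => ?_
      have hy : 0 < y := hy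
      by_cases hyR : y < R
      · simp only [indicator, mem_Iio, hyR, if_true, smul_eq_mul]
        rw [← Real.rpow_natCast, ← Real.rpow_add hy]
        congr 1
        rw [Nat.cast_sub hn]
        push_cast
        ring
      · simp [indicator, hyR]
    rw [h3, setIntegral_indicator measurableSet_Iio, Ioi_inter_Iio, ← integral_Ioc_eq_integral_Ioo,
      ← intervalIntegral.integral_of_le hR.le, integral_rpow (Or.inl (by linarith))]
    rw [sub_add_cancel, Real.zero_rpow hna.ne', sub_zero]
  rw [h2]
  simp only [nsmul_eq_mul, smul_eq_mul]
  ring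

/-- The square of the homogeneous Sobolev norm of order `s` of a function with Fourier
transform `k`. -/
noncomputable def homSobolevSq {n : ℕ} {F : Type*} [NormedAddCommGroup F] (s : ℝ) (k : Rn n → F) :
    ℝ≥0∞ :=
  ∫⁻ ξ, ENNReal.ofReal (‖ξ‖ ^ (2 * s)) * ‖k ξ‖ₑ ^ 2

/-- Cauchy–Schwarz after writing `1 = |ξ|^(-s) |ξ|^s`, which holds off the null set `{0}`. -/
theorem setLIntegral_ball_enorm_le {n : ℕ} (hn : 0 < n) {s : ℝ} (hs : 2 * s < n) :
    ∃ c : ℝ, 0 < c ∧ ∀ {F : Type} [NormedAddCommGroup F] (R : ℝ) (k : Rn n → F), 0 < R → AEStronglyMeasurable k volume →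
      ∫⁻ ξ in Metric.ball 0 R, ‖k ξ‖ₑ ≤
        ENNReal.ofReal (c * R ^ (n / 2 - s)) * homSobolevSq s k ^ (1 / 2 : ℝ) := by
  obtain ⟨c, hc, hcR⟩ := exists_setLIntegral_ball_norm_rpow hn hs
  refine ⟨√c, by positivity, fun R k hR hk => ?_⟩
  have : Nonempty (Fin n) := ⟨⟨0, hn⟩⟩
  have hne : ∀ᵐ ξ : Rn n ∂volume.restrict (Metric.ball 0 R), ξ ≠ 0 :=
    ae_restrict_of_ae (Measure.ae_ne volume 0)
  have h1 : ∫⁻ ξ in Metric.ball (0 : Rn n) R, ‖k ξ‖ₑ = ∫⁻ ξ in Metric.ball 0 R,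
      ((fun ξ : Rn n => ENNReal.ofReal (‖ξ‖ ^ (-s))) *
        fun ξ => ENNReal.ofReal (‖ξ‖ ^ s) * ‖k ξ‖ₑ) ξ := by
    refine lintegral_congr_ae ?_
    filter_upwards [hne] with ξ hξ
    have : 0 < ‖ξ‖ := norm_pos_iff.2 hξ
    rw [Pi.mul_apply, ← mul_assoc, ← ENNReal.ofReal_mul (by positivity), ← Real.rpow_add this]
    simp
  rw [h1]
  refine (ENNReal.lintegral_mul_le_Lp_mul_Lq _ Real.HolderConjugate.two_two
    (by fun_prop) ?_).trans ?_
  · exact (by fun_prop : Measurable fun ξ : Rn n => ENNReal.ofReal (‖ξ‖ ^ s)).aemeasurable.mul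
      hk.enorm.restrict
  · refine mul_le_mul' ?_ ?_
    · have : ∫⁻ ξ in Metric.ball (0 : Rn n) R, ENNReal.ofReal (‖ξ‖ ^ (-s)) ^ (2 : ℝ) =
          ENNReal.ofReal (c * R ^ (n - 2 * s)) := by
        rw [← hcR R hR]
        refine lintegral_congr fun ξ => ?_
        rw [ENNReal.ofReal_rpow_of_nonneg (by positivity) (by norm_num),
          ← Real.rpow_mul (by positivity)]
        congr 2
        ring
      rw [this, ENNReal.ofReal_rpow_of_nonneg (by positivity) (by norm_num)]
      apply le_of_eq
      congr 1
      rw [Real.mul_rpow hc.le (by positivity), ← Real.rpow_mul hR.le, Real.sqrt_eq_rpow]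
      congr 2
      ring
    · refine ENNReal.rpow_le_rpow ?_ (by norm_num)
      refine (setLIntegral_le_lintegral _ _).trans (le_of_eq ?_)
      refine lintegral_congr fun ξ => ?_
      rw [ENNReal.mul_rpow_of_nonneg _ _ (by norm_num),
        ENNReal.ofReal_rpow_of_nonneg (by positivity) (by norm_num),
        ← Real.rpow_mul (by positivity), ENNReal.rpow_ofNat]
      congr 3
      ring

/-- The real-interpolation cut: the part of `k` off `S` contributes at most `l / 2` in the sup norm,
so a value above `l` forces the image of the part on `S` to exceed `l / 2`. Chebyshev's inequality
and the isometry bound the measure of that set. -/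
theorem meas_lt_enorm_le_of_isometry {α β F : Type*} [MeasurableSpace α] [MeasurableSpace β]
    {μ : Measure α} {ν : Measure β} [NormedAddCommGroup F] [NormedSpace ℂ F]
    (Φ : Lp F 2 μ →ₗᵢ[ℂ] Lp F 2 ν) (hΦ : ∀ f, eLpNorm (Φ f) ∞ ν ≤ eLpNorm f 1 μ)
    (k : Lp F 2 μ) {S : Set α} (hS : MeasurableSet S) {l : ℝ} (hl : 0 < l)
    (h : ∫⁻ ξ in Sᶜ, ‖k ξ‖ₑ ∂μ ≤ ENNReal.ofReal (l / 2)) :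
    ν {x | l < ‖Φ k x‖} ≤ ENNReal.ofReal (4 / l ^ 2) * ∫⁻ ξ in S, ‖k ξ‖ₑ ^ 2 ∂μ := by
  have hk := Lp.memLp k
  set k₁ : Lp F 2 μ := (hk.indicator hS.compl).toLp _ with hk₁
  set k₂ : Lp F 2 μ := (hk.indicator hS).toLp _ with hk₂
  have hsum : k = k₁ + k₂ := by
    refine Lp.ext ?_
    filter_upwards [Lp.coeFn_add k₁ k₂, (hk.indicator hS.compl).coeFn_toLp,
      (hk.indicator hS).coeFn_toLp] with ξ h1 h2 h3
    rw [h1, Pi.add_apply, h2, h3]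
    by_cases hξ : ξ ∈ S <;> simp [indicator, hξ]
  have hΦk : Φ k =ᵐ[ν] Φ k₁ + Φ k₂ := by
    have := Lp.coeFn_add (Φ k₁) (Φ k₂)
    rwa [← map_add, ← hsum] at this
  have hsup : ∀ᵐ x ∂ν, ‖Φ k₁ x‖ₑ ≤ ENNReal.ofReal (l / 2) := by
    have h1 : eLpNorm (Φ k₁) ∞ ν ≤ ENNReal.ofReal (l / 2) := by
      refine (hΦ k₁).trans (le_trans (le_of_eq ?_) h)
      rw [eLpNorm_congr_ae (hk.indicator hS.compl).coeFn_toLp,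
        eLpNorm_indicator_eq_eLpNorm_restrict hS.compl, eLpNorm_one_eq_lintegral_enorm]
    rw [eLpNorm_exponent_top] at h1
    filter_upwards [enorm_ae_le_eLpNormEssSup (Φ k₁) ν] with x hx
    exact hx.trans h1
  have hl2 : ENNReal.ofReal (l / 2) ≠ 0 := by simpa using hl
  have h2 : ν {x | l < ‖Φ k x‖} ≤ ν {x | ENNReal.ofReal (l / 2) ≤ ‖Φ k₂ x‖ₑ} := by
    refine measure_mono_ae ?_
    filter_upwards [hΦk, hsup] with x hx1 hx2 hx3
    have hx3 : l < ‖Φ k x‖ := hx3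
    show ENNReal.ofReal (l / 2) ≤ ‖Φ k₂ x‖ₑ
    rw [hx1, Pi.add_apply] at hx3
    rw [← ofReal_norm, ENNReal.ofReal_le_ofReal_iff (by positivity)] at hx2
    rw [← ofReal_norm, ENNReal.ofReal_le_ofReal_iff (norm_nonneg _)]
    linarith [norm_add_le (Φ k₁ x) (Φ k₂ x)]
  refine h2.trans ((meas_ge_le_mul_pow_eLpNorm_enorm ν two_ne_zero ENNReal.ofNat_ne_top
    (Lp.aestronglyMeasurable _) hl2 (by simp)).trans (le_of_eq ?_))
  have h3 : eLpNorm (Φ k₂) 2 ν = eLpNorm k₂ 2 μ := by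
    have := Φ.norm_map k₂
    rwa [Lp.norm_def, Lp.norm_def, ENNReal.toReal_eq_toReal_iff' (Lp.eLpNorm_ne_top _)
      (Lp.eLpNorm_ne_top _)] at this
  rw [h3, eLpNorm_congr_ae (hk.indicator hS).coeFn_toLp, eLpNorm_indicator_eq_eLpNorm_restrict hS,
    eLpNorm_eq_lintegral_rpow_enorm_toReal two_ne_zero ENNReal.ofNat_ne_top]
  congr 1
  · rw [← ENNReal.ofReal_inv_of_pos (by positivity), ENNReal.toReal_ofNat,
      ENNReal.ofReal_rpow_of_pos (by positivity)]
    congr 1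
    norm_num
    ring
  · rw [ENNReal.toReal_ofNat, ← ENNReal.rpow_mul]
    norm_num

/-- Sobolev embedding by cutting frequencies at a radius that depends on the level `l`: the low
frequencies stay below `l / 2`, the high ones are estimated in `L²`, and integrating over `l` gives
the `L^q` norm. -/
theorem lintegral_enorm_rpow_le_homSobolevSq {n : ℕ} (hn : 0 < n) {q : ℝ} (hq : 2 < q) :
    ∃ C : ℝ, 0 < C ∧ ∀ {F : Type} [NormedAddCommGroup F] [NormedSpace ℂ F]
      (Φ : Lp F 2 (volume : Measure (Rn n)) →ₗᵢ[ℂ] Lp F 2 (volume : Measure (Rn n)))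
      (_ : ∀ f, eLpNorm (Φ f) ∞ volume ≤ eLpNorm f 1 volume)
      (k : Lp F 2 (volume : Measure (Rn n))),
      ∫⁻ x, ‖Φ k x‖ₑ ^ q ≤ ENNReal.ofReal C * homSobolevSq (n / 2 - n / q) k ^ (q / 2) := by
  have hn' : (0 : ℝ) < n := by exact_mod_cast hn
  have hq0 : 0 < q := by linarith
  set s : ℝ := n / 2 - n / q with hs
  have hs2 : 2 * s < n := by
    rw [hs]
    have : 0 < n / q := by positivity
    linarith
  obtain ⟨c, hc, hcR⟩ := setLIntegral_ball_enorm_le (n := n) hn hs2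
  refine ⟨4 * q / (q - 2) * (2 * c) ^ (q - 2), by
    have : 0 < q - 2 := by linarith
    positivity, fun {F} _ _ Φ hΦ k => ?_⟩
  have hkm : AEStronglyMeasurable k volume := Lp.aestronglyMeasurable k
  have hkF := fun (R : ℝ) hR => hcR R (k : Rn n → F) hR hkm
  set K := homSobolevSq s k with hK
  -- The values `⊤` and `0` are split off because the cutting radius below is defined through a
  -- positive real `κ = √K`.
  rcases eq_or_ne K ⊤ with hKt | hKt
  · rw [hKt, ENNReal.top_rpow_of_pos (by positivity), ENNReal.mul_top]
    · exact le_top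
    · have : 0 < q - 2 := by linarith
      simp only [ne_eq, ENNReal.ofReal_eq_zero, not_le]
      positivity
  rcases eq_or_ne K 0 with hK0 | hK0
  · have hk0 : k = 0 := by
      have h0 := hK0
      rw [hK, homSobolevSq, lintegral_eq_zero_iff' (by fun_prop)] at h0
      have : Nonempty (Fin n) := ⟨⟨0, hn⟩⟩
      refine Lp.ext ?_
      filter_upwards [h0, Measure.ae_ne volume (0 : Rn n), Lp.coeFn_zero F 2 volume] with ξ h1 h2 h3
      have : 0 < ‖ξ‖ := norm_pos_iff.2 h2
      rw [h3]
      have h4 : 0 < ‖ξ‖ ^ (2 * s) := by positivity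
      simpa [h4, h4.not_ge] using h1
    have h1 : ∀ᵐ x, ‖Φ k x‖ₑ ^ q = 0 := by
      rw [hk0, map_zero]
      filter_upwards [Lp.coeFn_zero F 2 (volume : Measure (Rn n))] with x hx
      rw [hx]
      simp [hq0]
    rw [lintegral_congr_ae h1]
    simp
  set κ : ℝ := √K.toReal with hκ
  have hKpos : 0 < K.toReal := ENNReal.toReal_pos hK0 hKt
  have hκ0 : 0 < κ := by positivity
  have hKhalf : K ^ (1 / 2 : ℝ) = ENNReal.ofReal κ := by
    rw [hκ, Real.sqrt_eq_rpow, ← ENNReal.ofReal_rpow_of_pos hKpos, ENNReal.ofReal_toReal hKt]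
  -- Chosen so that the ball `{lam < l}`, of radius `R = (l / b)^(q / n)`, satisfies `c R^(n/q) κ =
  -- l / 2`, the amount allowed to the low frequencies.
  set b : ℝ := 2 * c * κ with hb
  have hb0 : 0 < b := by positivity
  set lam : Rn n → ℝ := fun ξ => b * ‖ξ‖ ^ (n / q) with hlam
  have hlam_m : Measurable lam := by fun_prop
  have hdist : ∀ l : ℝ, 0 < l → volume {x | l < ‖Φ k x‖} ≤
      ENNReal.ofReal (4 / l ^ 2) * ∫⁻ ξ in {ξ | l ≤ lam ξ}, ‖k ξ‖ₑ ^ 2 := by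
    intro l hl
    have hS : MeasurableSet {ξ | l ≤ lam ξ} := measurableSet_le measurable_const hlam_m
    refine meas_lt_enorm_le_of_isometry Φ hΦ k hS hl ?_
    have hR : 0 < (l / b) ^ (q / n) := by positivity
    refine (lintegral_mono_set (t := Metric.ball 0 ((l / b) ^ (q / n))) ?_).trans
      ((hkF _ hR).trans (le_of_eq ?_))
    · intro ξ hξ
      simp only [hlam, mem_compl_iff, mem_ofPred_eq, not_le] at hξ
      rw [mem_ball_zero_iff]
      have h1 : ‖ξ‖ ^ (n / q) < l / b := by rw [lt_div_iff₀ hb0]; linarith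
      have h2 := Real.rpow_lt_rpow (by positivity) h1 (z := q / n) (by positivity)
      rwa [← Real.rpow_mul (norm_nonneg _), div_mul_div_cancel₀ hq0.ne',
        div_self hn'.ne', Real.rpow_one] at h2
    · rw [hKhalf, ← ENNReal.ofReal_mul (by positivity)]
      congr 1
      have : (n : ℝ) / 2 - s = n / q := by rw [hs]; ring
      rw [this, ← Real.rpow_mul (by positivity), div_mul_div_cancel₀ hn'.ne', div_self hq0.ne',
        Real.rpow_one, hb]
      field_simp
  -- With respect to `|k|² dξ`, the level bounds sum up to the layer-cake formula for `lam^(q-2)`;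
  -- since `(n/q)(q-2) = 2s`, this is the Sobolev norm.
  set ν := (volume : Measure (Rn n)).withDensity fun ξ => ‖k ξ‖ₑ ^ 2 with hν
  have hkm2 : AEMeasurable (fun ξ => ‖k ξ‖ₑ ^ 2) (volume : Measure (Rn n)) := by fun_prop
  have hlayer := lintegral_rpow_eq_lintegral_meas_le_mul ν (f := lam)
    (Eventually.of_forall fun ξ => by simp only [hlam]; positivity) hlam_m.aemeasurable
    (p := q - 2) (by linarith)
  have hlhs : ∫⁻ ξ, ENNReal.ofReal (lam ξ ^ (q - 2)) ∂ν = ENNReal.ofReal (b ^ (q - 2)) * K := by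
    rw [hν, lintegral_withDensity_eq_lintegral_mul₀ hkm2 (by fun_prop), hK, homSobolevSq,
      ← lintegral_const_mul'' _ (by fun_prop)]
    refine lintegral_congr fun ξ => ?_
    simp only [Pi.mul_apply, hlam]
    rw [Real.mul_rpow hb0.le (by positivity), ← Real.rpow_mul (norm_nonneg _),
      ENNReal.ofReal_mul (by positivity)]
    have : (n : ℝ) / q * (q - 2) = 2 * s := by rw [hs]; field_simp
    rw [this]
    ring
  have hstart := lintegral_rpow_eq_lintegral_meas_lt_mul (volume : Measure (Rn n))
    (f := fun x => ‖Φ k x‖) (Eventually.of_forall fun x => norm_nonneg _)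
    (Lp.aestronglyMeasurable _).norm.aemeasurable hq0
  have h0 : ∫⁻ x, ‖Φ k x‖ₑ ^ q = ∫⁻ x, ENNReal.ofReal (‖Φ k x‖ ^ q) := by
    refine lintegral_congr fun x => ?_
    rw [← ofReal_norm, ENNReal.ofReal_rpow_of_nonneg (norm_nonneg _) hq0.le]
  have hmid : ∫⁻ l in Ioi (0 : ℝ), volume {x | l < ‖Φ k x‖} * ENNReal.ofReal (l ^ (q - 1)) ≤
      4 * ∫⁻ l in Ioi (0 : ℝ), ν {ξ | l ≤ lam ξ} * ENNReal.ofReal (l ^ (q - 2 - 1)) := by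
    rw [← lintegral_const_mul' _ _ (by simp)]
    refine setLIntegral_mono' measurableSet_Ioi fun l hl => ?_
    have hl : 0 < l := hl
    rw [hν, withDensity_apply _ (measurableSet_le measurable_const hlam_m)]
    refine (mul_le_mul_left (hdist l hl) _).trans (le_of_eq ?_)
    rw [mul_right_comm, ← ENNReal.ofReal_mul (by positivity)]
    have : 4 / l ^ 2 * l ^ (q - 1) = 4 * l ^ (q - 2 - 1) := by
      rw [show q - 1 = (q - 2 - 1) + 2 by ring, Real.rpow_add hl, Real.rpow_two]
      field_simp
    rw [this, ENNReal.ofReal_mul (by norm_num)]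
    simp only [ENNReal.ofReal_ofNat]
    ring
  have hq2 : 0 < q - 2 := by linarith
  have hI : ∫⁻ l in Ioi (0 : ℝ), ν {ξ | l ≤ lam ξ} * ENNReal.ofReal (l ^ (q - 2 - 1)) =
      ENNReal.ofReal (b ^ (q - 2) / (q - 2)) * K := by
    have h1 := hlayer.symm.trans hlhs
    rw [div_eq_inv_mul, ENNReal.ofReal_mul (by positivity), mul_assoc, ← h1, ← mul_assoc,
      ← ENNReal.ofReal_mul (by positivity), inv_mul_cancel₀ hq2.ne']
    simp
  rw [h0, hstart]
  refine (mul_le_mul_right hmid _).trans (le_of_eq ?_)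
  rw [hI]
  have hKpow : K ^ (q / 2) = ENNReal.ofReal (κ ^ (q - 2)) * K := by
    rw [← ENNReal.ofReal_rpow_of_pos hκ0, ← hKhalf, ← ENNReal.rpow_mul]
    nth_rewrite 3 [← ENNReal.rpow_one K]
    rw [← ENNReal.rpow_add _ _ hK0 hKt]
    congr 1
    ring
  rw [hKpow, hb, Real.mul_rpow (by positivity) hκ0.le,
    show (4 : ℝ≥0∞) = ENNReal.ofReal 4 by simp]
  simp only [← mul_assoc]
  rw [← ENNReal.ofReal_mul (by positivity), ← ENNReal.ofReal_mul (by positivity),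
    ← ENNReal.ofReal_mul (by positivity)]
  congr 2
  field_simp

/-! ### The Fourier transform on `L²` as a map from `L¹` to `L^∞` -/

open FourierTransform

/-- If `f` is also integrable, Fubini moves the transform from the test function to `f`, so `u`
agrees almost everywhere with the Fourier integral of `f`. A general bilinear form `L` covers both
signs of the kernel. -/
theorem eLpNorm_top_le_of_integral_smul_eq_fourierIntegral {n : ℕ} {F : Type*}
    [NormedAddCommGroup F] [NormedSpace ℂ F] [CompleteSpace F]
    (L : Rn n →ₗ[ℝ] Rn n →ₗ[ℝ] ℝ) (hL : Continuous fun p : Rn n × Rn n => L p.1 p.2)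
    (f u : Lp F 2 (volume : Measure (Rn n)))
    (h : ∀ g : 𝓢(Rn n, ℂ), ∫ x, g x • u x =
      ∫ x, VectorFourier.fourierIntegral Real.fourierChar volume L g x • f x) :
    eLpNorm u ∞ volume ≤ eLpNorm f 1 volume := by
  rcases eq_or_ne (eLpNorm f 1 volume) ⊤ with ht | ht
  · rw [ht]; exact le_top
  have hf : MemLp f 1 volume := ⟨Lp.aestronglyMeasurable f, lt_top_iff_ne_top.2 ht⟩
  have hfi : Integrable f volume := memLp_one_iff_integrable.1 hf
  set v := VectorFourier.fourierIntegral Real.fourierChar volume L.flip f with hv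
  have hLf : Continuous fun p : Rn n × Rn n => L.flip p.1 p.2 := by
    simpa using! hL.comp continuous_swap
  have hvc : Continuous v :=
    VectorFourier.fourierIntegral_continuous Real.continuous_fourierChar hLf hfi
  have hu : LocallyIntegrable u volume := (Lp.memLp u).locallyIntegrable (by norm_num)
  have hvl : LocallyIntegrable v volume := hvc.locallyIntegrable
  have hae : ∀ᵐ x, u x = v x := by
    refine ae_eq_of_integral_contDiff_smul_eq hu hvl fun g hg hgs => ?_
    have hg₁ : HasCompactSupport (Complex.ofRealCLM ∘ g) := hgs.comp_left rfl
    have hg₂ : ContDiff ℝ ∞ (Complex.ofRealCLM ∘ g) := by fun_prop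
    have h1 := h (hg₁.toSchwartzMap hg₂)
    have h2 := VectorFourier.integral_fourierIntegral_smul_eq_flip (μ := (volume : Measure (Rn n)))
      (ν := (volume : Measure (Rn n))) (L := L) (f := hg₁.toSchwartzMap hg₂) (g := f)
      Real.continuous_fourierChar hL (SchwartzMap.integrable _) hfi
    have h3 := h1.trans h2
    simpa using h3
  rw [eLpNorm_congr_ae hae, eLpNorm_exponent_top, eLpNorm_one_eq_lintegral_enorm]
  refine eLpNormEssSup_le_of_ae_enorm_bound (Eventually.of_forall fun x => ?_)
  rw [← ofReal_integral_norm_eq_lintegral_enorm hfi, ← ofReal_norm]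
  exact ENNReal.ofReal_le_ofReal
    (VectorFourier.norm_fourierIntegral_le_integral_norm _ _ _ _ _)

section

variable {n : ℕ} {F : Type*} [NormedAddCommGroup F] [InnerProductSpace ℂ F] [CompleteSpace F]

theorem continuous_innerₗ (n : ℕ) :
    Continuous fun p : Rn n × Rn n => (innerₗ (Rn n)) p.1 p.2 := by
  simpa using! (continuous_inner : Continuous fun p : Rn n × Rn n => inner ℝ p.1 p.2)

theorem eLpNorm_fourier_top_le (f : Lp F 2 (volume : Measure (Rn n))) :
    eLpNorm (𝓕 f : Lp F 2 (volume : Measure (Rn n))) ∞ volume ≤ eLpNorm f 1 volume := by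
  refine eLpNorm_top_le_of_integral_smul_eq_fourierIntegral (innerₗ (Rn n))
    (continuous_innerₗ n) f _ fun g => ?_
  rw [← Lp.toTemperedDistribution_apply, ← Lp.fourier_toTemperedDistribution_eq,
    TemperedDistribution.fourier_apply, Lp.toTemperedDistribution_apply]
  rw [SchwartzMap.fourier_coe]
  rfl

theorem eLpNorm_fourierInv_top_le (f : Lp F 2 (volume : Measure (Rn n))) :
    eLpNorm (𝓕⁻ f : Lp F 2 (volume : Measure (Rn n))) ∞ volume ≤ eLpNorm f 1 volume := by
  refine eLpNorm_top_le_of_integral_smul_eq_fourierIntegral (-innerₗ (Rn n))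
    (continuous_innerₗ n).neg f _ fun g => ?_
  rw [← Lp.toTemperedDistribution_apply, ← Lp.fourierInv_toTemperedDistribution_eq,
    TemperedDistribution.fourierInv_apply, Lp.toTemperedDistribution_apply]
  rw [SchwartzMap.fourierInv_coe]
  rfl

end

/-! ### From weighted `L²` to `L^q`, uniformly under scaling -/

theorem lintegral_one_add_mul_norm_sq_rpow {n : ℕ} {ρ : ℝ} (hρ : (n : ℝ) / 2 < ρ) :
    ∃ c : ℝ, 0 ≤ c ∧ ∀ T : ℝ, 0 < T →
      ∫⁻ ξ : Rn n, ENNReal.ofReal ((1 + T * ‖ξ‖ ^ 2) ^ (-ρ)) =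
        ENNReal.ofReal (c * T ^ (-(n / 2 : ℝ))) := by
  have hI : Integrable (fun ξ : Rn n => (1 + ‖ξ‖ ^ 2) ^ (-ρ)) volume := by
    have := integrable_rpow_neg_one_add_norm_sq (E := Rn n) (μ := volume) (r := 2 * ρ)
      (by simp; linarith)
    convert this using 3
    ring
  refine ⟨∫ ξ : Rn n, (1 + ‖ξ‖ ^ 2) ^ (-ρ), integral_nonneg fun ξ => by positivity,
    fun T hT => ?_⟩
  have hs : 0 < √T := by positivity
  have h1 : ∀ ξ : Rn n, (1 + T * ‖ξ‖ ^ 2) ^ (-ρ) =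
      (fun η : Rn n => (1 + ‖η‖ ^ 2) ^ (-ρ)) (√T • ξ) := by
    intro ξ
    simp only [norm_smul, mul_pow, Real.norm_of_nonneg hs.le, Real.sq_sqrt hT.le]
  simp_rw [h1]
  rw [← ofReal_integral_eq_lintegral_ofReal (hI.comp_smul hs.ne')
    (Eventually.of_forall fun ξ => by positivity),
    Measure.integral_comp_smul volume (fun η : Rn n => (1 + ‖η‖ ^ 2) ^ (-ρ))]
  congr 1
  rw [smul_eq_mul, mul_comm, abs_of_pos (by positivity)]
  congr 1
  rw [Real.sqrt_eq_rpow, ← Real.rpow_natCast, ← Real.rpow_mul hT.le, Real.rpow_neg hT.le]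
  simp
  ring_nf

theorem eLpNorm_two_smul_eq {α F : Type*} [MeasurableSpace α] {μ : Measure α}
    [NormedAddCommGroup F] [NormedSpace ℝ F] {w : α → ℝ} (hw : ∀ x, 0 ≤ w x) (k : α → F) :
    eLpNorm (fun x => w x • k x) 2 μ =
      (∫⁻ x, ENNReal.ofReal (w x ^ 2) * ‖k x‖ₑ ^ 2 ∂μ) ^ (1 / 2 : ℝ) := by
  rw [eLpNorm_eq_lintegral_rpow_enorm_toReal two_ne_zero ENNReal.ofNat_ne_top]
  simp only [ENNReal.toReal_ofNat, ENNReal.rpow_ofNat]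
  congr 1
  refine lintegral_congr fun x => ?_
  rw [enorm_smul, mul_pow, Real.enorm_eq_ofReal (hw x), ← ENNReal.ofReal_pow (hw x)]

/-- Isometries of `L²` that map `L¹` to `L^∞` map a weighted `L²` space to `L^q`. -/
theorem exists_eLpNorm_le_weighted {n : ℕ} (hn : 0 < n) {q : ℝ≥0∞} (hq : 2 ≤ q) {ρ : ℝ}
    (hρ : (n : ℝ) * (1 / 2 - (q⁻¹).toReal) ≤ ρ)
    (hρ' : q = ⊤ → (n : ℝ) * (1 / 2 - (q⁻¹).toReal) < ρ) :
    ∃ C : ℝ, 0 < C ∧ ∀ {F : Type} [NormedAddCommGroup F] [NormedSpace ℂ F]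
      (Φ : Lp F 2 (volume : Measure (Rn n)) →ₗᵢ[ℂ] Lp F 2 (volume : Measure (Rn n)))
      (_ : ∀ f, eLpNorm (Φ f) ∞ volume ≤ eLpNorm f 1 volume)
      (k : Lp F 2 (volume : Measure (Rn n))) (T : ℝ), 1 ≤ T →
      eLpNorm (Φ k) q volume ≤
        ENNReal.ofReal (C * T ^ (-((n : ℝ) / 2 * (1 / 2 - (q⁻¹).toReal)))) *
          eLpNorm (fun ξ => ((1 + T * ‖ξ‖ ^ 2) ^ (ρ / 2) : ℝ) • k ξ) 2 volume := by
  have hn' : (0 : ℝ) < n := by exact_mod_cast hn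
  rcases eq_or_ne q ⊤ with rfl | hqt
  -- For `q = ∞`, Cauchy–Schwarz bounds the `L¹` norm of `k`; the strict inequality is `ρ > n / 2`,
  -- which makes the inverse weight integrable.
  · obtain ⟨c, hc, hcT⟩ := lintegral_one_add_mul_norm_sq_rpow (n := n) (ρ := ρ) (by
      have := hρ' rfl
      simp at this
      linarith)
    refine ⟨√c + 1, by positivity, fun {F} _ _ Φ hΦ k T hT => (hΦ k).trans ?_⟩
    have hT0 : 0 < T := by linarith
    rw [eLpNorm_two_smul_eq (fun ξ => by positivity), eLpNorm_one_eq_lintegral_enorm]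
    have h1 : ∫⁻ ξ, ‖k ξ‖ₑ = ∫⁻ ξ,
      ((fun ξ : Rn n => ENNReal.ofReal ((1 + T * ‖ξ‖ ^ 2) ^ (-(ρ / 2)))) *
        fun ξ => ENNReal.ofReal ((1 + T * ‖ξ‖ ^ 2) ^ (ρ / 2)) * ‖k ξ‖ₑ) ξ := by
      refine lintegral_congr fun ξ => ?_
      have : 0 < 1 + T * ‖ξ‖ ^ 2 := by positivity
      rw [Pi.mul_apply, ← mul_assoc, ← ENNReal.ofReal_mul (by positivity), ← Real.rpow_add this]
      simp
    rw [h1]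
    have hm : ∀ a : ℝ, Measurable fun ξ : Rn n =>
        ENNReal.ofReal ((1 + T * ‖ξ‖ ^ 2) ^ a) := fun a => by fun_prop
    refine (ENNReal.lintegral_mul_le_Lp_mul_Lq _ Real.HolderConjugate.two_two
      (hm _).aemeasurable ((hm _).aemeasurable.mul (Lp.aestronglyMeasurable k).enorm)).trans ?_
    refine mul_le_mul' ?_ (le_of_eq ?_)
    · have h2 : ∫⁻ ξ : Rn n, ENNReal.ofReal ((1 + T * ‖ξ‖ ^ 2) ^ (-(ρ / 2))) ^ (2 : ℝ) =
          ENNReal.ofReal (c * T ^ (-(n / 2 : ℝ))) := by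
        rw [← hcT T hT0]
        refine lintegral_congr fun ξ => ?_
        rw [ENNReal.ofReal_rpow_of_nonneg (by positivity) (by norm_num),
          ← Real.rpow_mul (by positivity)]
        congr 2
        ring
      rw [h2, ENNReal.ofReal_rpow_of_nonneg (by positivity) (by norm_num)]
      apply ENNReal.ofReal_le_ofReal
      rw [Real.mul_rpow hc (by positivity), ← Real.rpow_mul hT0.le, ← Real.sqrt_eq_rpow]
      have : -((n : ℝ) / 2) * (1 / 2) = -((n : ℝ) / 2 * (1 / 2 - ((⊤ : ℝ≥0∞)⁻¹).toReal)) := by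
        simp
      rw [this]
      gcongr
      linarith
    · congr 1
      refine lintegral_congr fun ξ => ?_
      rw [Pi.mul_apply, ENNReal.rpow_ofNat, mul_pow, ENNReal.ofReal_pow (by positivity)]
  set q' := q.toReal with hq'
  have hqq : q = ENNReal.ofReal q' := (ENNReal.ofReal_toReal hqt).symm
  have hq0 : 2 ≤ q' := by
    have := ENNReal.toReal_mono hqt hq
    simpa using this
  have hinv : (q⁻¹).toReal = 1 / q' := by simp [hq']
  rw [hinv] at hρ hρ' ⊢
  -- For `q = 2` the isometry alone is enough, as the weight is at least `1`. For `2 < q < ∞` the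
  -- homogeneous Sobolev weight is compared with the inhomogeneous one: `|ξ|^(2s) ≤ T^(-s) (1 +
  -- T|ξ|²)^ρ`.
  rcases eq_or_lt_of_le hq0 with h2 | h2
  · refine ⟨1, one_pos, fun {F} _ _ Φ hΦ k T hT => ?_⟩
    have hq2 : q = 2 := by rw [hqq, ← h2]; simp
    have hρ0 : 0 ≤ ρ := by rw [← h2] at hρ; simpa using hρ
    rw [← h2]
    simp only [sub_self, mul_zero, neg_zero, Real.rpow_zero, mul_one, ENNReal.ofReal_one, one_mul,
      hq2]
    have h3 : eLpNorm (Φ k) 2 volume = eLpNorm k 2 volume := by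
      have := Φ.norm_map k
      rwa [Lp.norm_def, Lp.norm_def, ENNReal.toReal_eq_toReal_iff' (Lp.eLpNorm_ne_top _)
        (Lp.eLpNorm_ne_top _)] at this
    rw [h3]
    refine eLpNorm_mono fun ξ => ?_
    rw [norm_smul, Real.norm_of_nonneg (by positivity)]
    refine le_mul_of_one_le_left (norm_nonneg _) (Real.one_le_rpow ?_ (by linarith))
    have : 0 ≤ T * ‖ξ‖ ^ 2 := by positivity
    linarith
  · obtain ⟨C, hC, hCk⟩ := lintegral_enorm_rpow_le_homSobolevSq (n := n) hn h2
    refine ⟨C ^ (1 / q'), by positivity, fun {F} _ _ Φ hΦ k T hT => ?_⟩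
    have hq0' : 0 < q' := by linarith
    have hT0 : 0 < T := by linarith
    set s : ℝ := n / 2 - n / q' with hs
    have hs0 : 0 ≤ s := by
      have : (n : ℝ) / q' ≤ n / 2 := by gcongr
      linarith
    have hsρ : s ≤ ρ := by
      refine le_trans (le_of_eq ?_) hρ
      rw [hs]; ring
    rw [hqq, eLpNorm_eq_lintegral_rpow_enorm_toReal (by simpa using hq0')
      ENNReal.ofReal_ne_top, ENNReal.toReal_ofReal hq0'.le, eLpNorm_two_smul_eq
      (fun ξ => by positivity)]
    refine (ENNReal.rpow_le_rpow (hCk Φ hΦ k) (by positivity)).trans ?_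
    rw [ENNReal.mul_rpow_of_nonneg _ _ (by positivity), ← ENNReal.rpow_mul,
      ENNReal.ofReal_rpow_of_pos hC, ENNReal.ofReal_mul (by positivity), mul_assoc]
    refine mul_le_mul_right ?_ _
    have hsq : T ^ (-((n : ℝ) / 2 * (1 / 2 - 1 / q'))) = (T ^ (-s)) ^ (1 / 2 : ℝ) := by
      rw [← Real.rpow_mul hT0.le]
      congr 1
      rw [hs]; ring
    rw [hsq, ← ENNReal.ofReal_rpow_of_pos (by positivity),
      ← ENNReal.mul_rpow_of_nonneg _ _ (by norm_num), show q' / 2 * (1 / q') = 1 / 2 by field_simp]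
    refine ENNReal.rpow_le_rpow ?_ (by norm_num)
    rw [homSobolevSq, ← lintegral_const_mul' _ _ ENNReal.ofReal_ne_top]
    refine lintegral_mono fun ξ => ?_
    rw [← mul_assoc, ← ENNReal.ofReal_mul (by positivity)]
    gcongr
    have h1 : 0 ≤ T * ‖ξ‖ ^ 2 := by positivity
    have h3 : ‖ξ‖ ^ (2 * s) = T ^ (-s) * (T * ‖ξ‖ ^ 2) ^ s := by
      rw [Real.mul_rpow hT0.le (by positivity), ← mul_assoc, ← Real.rpow_add hT0, neg_add_cancel,
        Real.rpow_zero, one_mul, Real.rpow_mul (norm_nonneg _), Real.rpow_two]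
    rw [h3, ← Real.rpow_natCast ((1 + T * ‖ξ‖ ^ 2) ^ (ρ / 2)), ← Real.rpow_mul (by positivity)]
    gcongr
    calc (T * ‖ξ‖ ^ 2) ^ s ≤ (1 + T * ‖ξ‖ ^ 2) ^ s := by gcongr; linarith
      _ ≤ (1 + T * ‖ξ‖ ^ 2) ^ (ρ / 2 * (2 : ℕ)) := by
        apply Real.rpow_le_rpow_of_exponent_le (by linarith)
        push_cast
        linarith

/-! ### Duality: from `L^p` to weighted `L²` -/

/-- Riesz representation; the conjugate turns the sesquilinear pairing into the bilinear one used by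
distributions. -/
theorem exists_Lp_two_integral_mul_eq {α : Type*} [MeasurableSpace α] {μ : Measure α}
    (T : Lp ℂ 2 μ →L[ℂ] ℂ) :
    ∃ h : Lp ℂ 2 μ, ‖h‖ ≤ ‖T‖ ∧ ∀ φ : Lp ℂ 2 μ, ∫ x, φ x * h x ∂μ = T φ := by
  refine ⟨star ((InnerProductSpace.toDual ℂ _).symm T), ?_, fun φ => ?_⟩
  · rw [← LinearIsometryEquiv.norm_map (InnerProductSpace.toDual ℂ _).symm T, Lp.norm_def,
      Lp.norm_def, eLpNorm_congr_ae (Lp.coeFn_star _), eLpNorm_star]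
  · rw [← InnerProductSpace.toDual_symm_apply, L2.inner_def]
    refine integral_congr_ae ?_
    filter_upwards [Lp.coeFn_star ((InnerProductSpace.toDual ℂ _).symm T)] with x hx
    rw [hx]
    simp

theorem exists_Lp_two_integral_smul_eq {α : Type*} [MeasurableSpace α] {μ : Measure α} {d : ℕ}
    (T : Lp ℂ 2 μ →L[ℂ] Cd d) :
    ∃ f : Lp (Cd d) 2 μ, ‖f‖ ≤ d * ‖T‖ ∧ ∀ φ : Lp ℂ 2 μ, ∫ x, φ x • f x ∂μ = T φ := by
  choose h hh hT using fun i : Fin d =>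
    exists_Lp_two_integral_mul_eq ((EuclideanSpace.proj i : Cd d →L[ℂ] ℂ) ∘L T)
  have hPn : ∀ i : Fin d, ‖(EuclideanSpace.proj i : Cd d →L[ℂ] ℂ)‖ ≤ 1 := fun i =>
    ContinuousLinearMap.opNorm_le_bound _ zero_le_one fun x => by
      simpa using PiLp.norm_apply_le x i
  have hhn : ∀ i, ‖h i‖ ≤ ‖T‖ := fun i => (hh i).trans <| by
    calc _ ≤ ‖(EuclideanSpace.proj i : Cd d →L[ℂ] ℂ)‖ * ‖T‖ := ContinuousLinearMap.opNorm_comp_le _ _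
      _ ≤ 1 * ‖T‖ := by gcongr; exact hPn i
      _ = ‖T‖ := one_mul _
  have hm : MemLp (fun x => WithLp.toLp 2 fun i => h i x : α → Cd d) 2 μ :=
    MemLp.of_eval_piLp fun i => Lp.memLp (h i)
  refine ⟨hm.toLp _, ?_, fun φ => ?_⟩
  · have h1 : eLpNorm (fun x => WithLp.toLp 2 fun i => h i x : α → Cd d) 2 μ ≤
        ∑ i, eLpNorm (h i) 2 μ := by
      have h2 := eLpNorm_sum_le (s := Finset.univ) (f := fun i x => ‖h i x‖)
        (fun i _ => (Lp.aestronglyMeasurable (h i)).norm) (one_le_two (α := ℝ≥0∞))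
      simp only [eLpNorm_norm] at h2
      refine le_trans ?_ h2
      · refine eLpNorm_mono_real fun x => ?_
        rw [EuclideanSpace.norm_eq, Finset.sum_apply]
        refine Real.sqrt_le_iff.2 ⟨Finset.sum_nonneg fun i _ => norm_nonneg _, ?_⟩
        exact Finset.sum_sq_le_sq_sum_of_nonneg fun i _ => norm_nonneg _
    rw [Lp.norm_toLp]
    refine (ENNReal.toReal_mono (ENNReal.sum_ne_top.2 fun i _ => Lp.eLpNorm_ne_top _) h1).trans ?_
    rw [ENNReal.toReal_sum fun i _ => Lp.eLpNorm_ne_top _]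
    refine (Finset.sum_le_sum fun i _ => hhn i).trans ?_
    simp
  · have hint : Integrable (fun x => φ x • (WithLp.toLp 2 fun i => h i x : Cd d)) μ :=
      memLp_one_iff_integrable.1 (hm.smul (Lp.memLp φ))
    have h2 : ∫ x, φ x • (hm.toLp _) x ∂μ = ∫ x, φ x • (WithLp.toLp 2 fun i => h i x : Cd d) ∂μ := by
      refine integral_congr_ae ?_
      filter_upwards [hm.coeFn_toLp] with x hx
      rw [hx]
    rw [h2]
    ext i
    have h3 := (EuclideanSpace.proj i : Cd d →L[ℂ] ℂ).integral_comp_comm hint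
    have h4 := hT i φ
    exact h3.symm.trans h4

/-- A tempered distribution that is bounded with respect to the `L²` norm is an `L²` function. -/
theorem exists_Lp_two_eq_of_norm_apply_le {n d : ℕ} (u : 𝓢'(Rn n, Cd d)) {K : ℝ} (hK : 0 ≤ K)
    (hu : ∀ ψ : 𝓢(Rn n, ℂ), ‖u ψ‖ ≤ K * ‖ψ.toLp 2 (volume : Measure (Rn n))‖) :
    ∃ f : Lp (Cd d) 2 (volume : Measure (Rn n)), u = f ∧ ‖f‖ ≤ d * K := by
  let e : 𝓢(Rn n, ℂ) →ₗ[ℂ] Lp ℂ 2 (volume : Measure (Rn n)) :=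
    (SchwartzMap.toLpCLM ℂ ℂ 2 volume : 𝓢(Rn n, ℂ) →L[ℂ] _).toLinearMap
  have hdense : DenseRange e :=
    SchwartzMap.denseRange_toLpCLM (E := Rn n) (F := ℂ) (p := 2) ENNReal.ofNat_ne_top
  let u' : 𝓢(Rn n, ℂ) →ₗ[ℂ] Cd d := ⟨⟨fun ψ => u ψ, map_add u⟩, map_smul u⟩
  have hTu : ∀ ψ, u'.extendOfNorm e (ψ.toLp 2 volume) = u ψ := fun ψ =>
    LinearMap.extendOfNorm_eq hdense ⟨K, hu⟩ ψ
  have hTn : ‖u'.extendOfNorm e‖ ≤ K := LinearMap.opNorm_extendOfNorm_le hdense hK hu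
  obtain ⟨f, hf, hfT⟩ := exists_Lp_two_integral_smul_eq (u'.extendOfNorm e)
  refine ⟨f, ?_, hf.trans (by gcongr)⟩
  ext1 ψ
  rw [← hTu, ← hfT, Lp.toTemperedDistribution_apply]
  refine integral_congr_ae ?_
  filter_upwards [ψ.coeFn_toLp 2 volume] with x hx
  rw [hx]

/-- The weight `(1 + T |ξ|²) ^ s`. -/
noncomputable def scaledWeight {n : ℕ} (T s : ℝ) (ξ : Rn n) : ℝ := (1 + T * ‖ξ‖ ^ 2) ^ s

theorem scaledWeight_pos {n : ℕ} {T : ℝ} (hT : 0 ≤ T) (s : ℝ) (ξ : Rn n) :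
    0 < scaledWeight T s ξ := by
  unfold scaledWeight
  positivity

theorem scaledWeight_hasTemperateGrowth {n : ℕ} {T : ℝ} (hT : 0 ≤ T) (s : ℝ) :
    (fun ξ : Rn n => (scaledWeight T s ξ : ℂ)).HasTemperateGrowth := by
  have h := (Function.hasTemperateGrowth_one_add_norm_sq_rpow (Rn n) s).comp
    ((√T • ContinuousLinearMap.id ℝ (Rn n)).hasTemperateGrowth)
  have h2 := (Complex.ofRealCLM.hasTemperateGrowth).comp h
  convert h2 using 1
  ext ξ
  simp [scaledWeight, norm_smul, mul_pow, Real.sq_sqrt hT]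

theorem norm_toTemperedDistribution_apply_le {n d : ℕ} {p : ℝ≥0∞} [hp : Fact (1 ≤ p)]
    (g : Lp (Cd d) p (volume : Measure (Rn n))) (φ : 𝓢(Rn n, ℂ)) :
    ‖(g : 𝓢'(Rn n, Cd d)) φ‖ₑ ≤ eLpNorm φ (1 - p⁻¹)⁻¹ volume * ‖g‖ₑ := by
  rw [Lp.toTemperedDistribution_apply]
  refine (enorm_integral_le_lintegral_enorm _).trans ?_
  have hc : ENNReal.HolderConjugate p (1 - p⁻¹)⁻¹ :=
    ENNReal.HolderConjugate.inv_one_sub_inv' hp.out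
  have ht : ENNReal.HolderTriple (1 - p⁻¹)⁻¹ p 1 := hc.symm
  have := eLpNorm_smul_le_mul_eLpNorm (p := (1 - p⁻¹)⁻¹) (q := p) (r := 1)
    (Lp.aestronglyMeasurable g) (φ.continuous.aestronglyMeasurable (μ := volume))
  rw [eLpNorm_one_eq_lintegral_enorm] at this
  rwa [Lp.enorm_def]

/-- The Fourier transform maps `L^p` to a weighted `L²` space. -/
theorem exists_smulLeftCLM_fourier_eq {n : ℕ} (d : ℕ) (hn : 0 < n) {p : ℝ≥0∞} [hp1 : Fact (1 ≤ p)]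
    (hp : p ≤ 2) {ρ : ℝ} (hρ : (n : ℝ) * ((p⁻¹).toReal - 1 / 2) ≤ ρ)
    (hρ' : p = 1 → (n : ℝ) * ((p⁻¹).toReal - 1 / 2) < ρ) :
    ∃ C : ℝ, 0 < C ∧ ∀ (g : Lp (Cd d) p (volume : Measure (Rn n))) (T : ℝ), 1 ≤ T →
      ∃ f : Lp (Cd d) 2 (volume : Measure (Rn n)),
        smulLeftCLM (Cd d) (fun ξ => (scaledWeight T (-(ρ / 2)) ξ : ℂ)) (𝓕 (g : 𝓢'(Rn n, Cd d))) =
          f ∧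
        ‖f‖ ≤ C * T ^ (-((n : ℝ) / 2 * ((p⁻¹).toReal - 1 / 2))) * ‖g‖ := by
  set p' : ℝ≥0∞ := (1 - p⁻¹)⁻¹ with hp'
  have hpinv : p⁻¹ ≤ 1 := ENNReal.inv_le_one.2 hp1.out
  have hp'inv : (p'⁻¹).toReal = 1 - (p⁻¹).toReal := by
    rw [hp', inv_inv, ENNReal.toReal_sub_of_le hpinv ENNReal.one_ne_top, ENNReal.toReal_one]
  have hp'2 : 2 ≤ p' := by
    rw [hp', ENNReal.le_inv_iff_le_inv]
    have h2 : (2 : ℝ≥0∞)⁻¹ ≤ p⁻¹ := ENNReal.inv_le_inv.2 hp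
    rw [tsub_le_iff_right]
    calc (1 : ℝ≥0∞) = 2⁻¹ + 2⁻¹ := ENNReal.inv_two_add_inv_two.symm
      _ ≤ 2⁻¹ + p⁻¹ := by gcongr
  have hp'1 : p' = ⊤ → p = 1 := by
    intro h
    rw [hp', ENNReal.inv_eq_top, tsub_eq_zero_iff_le, ENNReal.one_le_inv] at h
    exact le_antisymm h hp1.out
  have hexp : (1 : ℝ) / 2 - (p'⁻¹).toReal = (p⁻¹).toReal - 1 / 2 := by rw [hp'inv]; ring
  obtain ⟨C, hC, hCk⟩ := exists_eLpNorm_le_weighted hn hp'2 (ρ := ρ) (by rwa [hexp])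
    (fun h => by rw [hexp]; exact hρ' (hp'1 h))
  rw [hexp] at hCk
  -- The factor `d` arises from representing a `ℂᵈ`-valued functional coordinate by coordinate; `d +
  -- 1` keeps the constant positive for `d = 0`.
  refine ⟨(d + 1) * C, by positivity, fun g T hT => ?_⟩
  have hT0 : 0 < T := by linarith
  set w : Rn n → ℂ := fun ξ => (scaledWeight T (-(ρ / 2)) ξ : ℂ) with hw
  have hwt : w.HasTemperateGrowth := scaledWeight_hasTemperateGrowth hT0.le _
  set B : ℝ := C * T ^ (-((n : ℝ) / 2 * ((p⁻¹).toReal - 1 / 2))) with hB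
  have hB0 : 0 < B := by positivity
  obtain ⟨f, hf, hfn⟩ := exists_Lp_two_eq_of_norm_apply_le
    (smulLeftCLM (Cd d) w (𝓕 (g : 𝓢'(Rn n, Cd d)))) (K := B * ‖g‖) (by positivity) (by
      intro ψ
      -- By duality the functional is `ψ ↦ ⟨g, 𝓕(wψ)⟩`. Hölder leaves the `L^{p'}` norm of `𝓕(wψ)`,
      -- and in the weighted `L²` bound for it the weight cancels `w`, leaving `‖ψ‖₂`.
      set φ : 𝓢(Rn n, ℂ) := SchwartzMap.smulLeftCLM ℂ w ψ with hφ
      have h1 : smulLeftCLM (Cd d) w (𝓕 (g : 𝓢'(Rn n, Cd d))) ψ =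
          (g : 𝓢'(Rn n, Cd d)) (𝓕 φ) := rfl
      have h2 : eLpNorm (𝓕 φ : 𝓢(Rn n, ℂ)) p' volume ≤ ENNReal.ofReal B * ‖ψ.toLp 2 (volume : Measure (Rn n))‖ₑ := by
        have h3 := hCk (Lp.fourierTransformₗᵢ (Rn n) ℂ).toLinearIsometry
          (fun f => eLpNorm_fourier_top_le f) (φ.toLp 2 volume) T hT
        have h4 : (Lp.fourierTransformₗᵢ (Rn n) ℂ).toLinearIsometry (φ.toLp 2 volume) =
            (𝓕 φ).toLp 2 volume := SchwartzMap.toLp_fourier_eq φ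
        rw [h4, eLpNorm_congr_ae ((𝓕 φ).coeFn_toLp 2 volume)] at h3
        refine h3.trans (le_of_eq ?_)
        congr 1
        rw [Lp.enorm_def]
        refine eLpNorm_congr_ae ?_
        filter_upwards [φ.coeFn_toLp 2 volume, ψ.coeFn_toLp 2 volume] with ξ h5 h6
        rw [h5, h6, hφ, SchwartzMap.smulLeftCLM_apply_apply hwt]
        simp only [hw, scaledWeight, smul_eq_mul, Complex.real_smul]
        rw [← mul_assoc, ← Complex.ofReal_mul, ← Real.rpow_add (by positivity)]
        simp
      have h7 := (norm_toTemperedDistribution_apply_le g (𝓕 φ)).trans (mul_le_mul_left h2 _)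
      rw [h1]
      simp only [← ofReal_norm] at h7
      rw [← ENNReal.ofReal_mul (by positivity), ← ENNReal.ofReal_mul (by positivity),
        ENNReal.ofReal_le_ofReal_iff (by positivity)] at h7
      linarith)
  refine ⟨f, hf, hfn.trans ?_⟩
  have : 0 ≤ B * ‖g‖ := by positivity
  calc d * (B * ‖g‖) ≤ (d + 1) * (B * ‖g‖) := by linarith
    _ = _ := by rw [hB]; ring

/-! ### Hypocoercivity in a Hilbert space -/

/-- A strictly log-concave decreasing sequence of weights. -/
theorem exists_logConcave_weights (m : ℕ) {δ : ℝ} (hδ0 : 0 < δ) (hδ1 : δ ≤ 1) :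
    ∃ ε : ℕ → ℝ, ε 0 = 1 ∧ (∀ j, 0 < ε j) ∧ (∀ j ≤ m, ε (j + 1) ≤ ε j) ∧
      (∀ j ≤ m, ε m ≤ ε j) ∧ (∀ j < m, ε (j + 1) ≤ δ ^ 2) ∧
      ∀ j < m, ε (j + 1) ^ 2 = δ ^ 2 * (ε j * ε (j + 2)) := by
  set e : ℕ → ℕ := fun j => j * (2 * (m + 2) - j) with he
  have he0 : e 0 = 0 := by simp [he]
  have hemono : ∀ j, j ≤ m → e j ≤ e (j + 1) := by
    intro j hj
    obtain ⟨k, rfl⟩ := Nat.exists_eq_add_of_le hj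
    simp only [he]
    rw [show 2 * (j + k + 2) - j = j + 2 * k + 4 by omega,
      show 2 * (j + k + 2) - (j + 1) = j + 2 * k + 3 by omega]
    nlinarith
  have hebig : ∀ j, j < m → 2 ≤ e (j + 1) := by
    intro j hj
    obtain ⟨k, rfl⟩ := Nat.exists_eq_add_of_lt hj
    simp only [he]
    rw [show 2 * (j + k + 1 + 2) - (j + 1) = j + 2 * k + 5 by omega]
    nlinarith
  have hecon : ∀ j, j < m → e j + e (j + 2) + 2 = 2 * e (j + 1) := by
    intro j hj
    obtain ⟨k, rfl⟩ := Nat.exists_eq_add_of_lt hj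
    simp only [he]
    rw [show 2 * (j + k + 1 + 2) - (j + 1) = j + 2 * k + 5 by omega,
      show 2 * (j + k + 1 + 2) - (j + 2) = j + 2 * k + 4 by omega,
      show 2 * (j + k + 1 + 2) - j = j + 2 * k + 6 by omega]
    ring
  have hmono : ∀ j ≤ m, δ ^ e (j + 1) ≤ δ ^ e j := fun j hj =>
    pow_le_pow_of_le_one hδ0.le hδ1 (hemono j hj)
  refine ⟨fun j => δ ^ e j, by simp [he0], fun j => by positivity, hmono, fun j hj => ?_,
    fun j hj => pow_le_pow_of_le_one hδ0.le hδ1 (hebig j hj), fun j hj => ?_⟩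
  · have : ∀ k, j ≤ k → k ≤ m → δ ^ e k ≤ δ ^ e j := by
      intro k hk
      induction k, hk using Nat.le_induction with
      | base => exact fun _ => le_rfl
      | succ k _ ih => exact fun hk => (hmono k (by omega)).trans (ih (by omega))
    exact this m hj le_rfl
  · simp only
    rw [← pow_add, ← pow_add, ← pow_mul]
    congr 1
    have := hecon j hj
    omega

theorem weighted_mul_le_of_sq_eq {δ e₀ e₁ e₂ x y : ℝ} (hδ : 0 ≤ δ) (h0 : 0 ≤ e₀) (h2 : 0 ≤ e₂)
    (h : e₁ ^ 2 = δ ^ 2 * (e₀ * e₂)) :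
    e₁ * (x * y) ≤ δ / 2 * (e₀ * x ^ 2 + e₂ * y ^ 2) := by
  refine (abs_le_of_sq_le_sq' ?_ (by positivity)).2
  have h3 : (e₁ * (x * y)) ^ 2 = δ ^ 2 * ((e₀ * x ^ 2) * (e₂ * y ^ 2)) := by
    rw [mul_pow, h]; ring
  have h4 := mul_nonneg (sq_nonneg δ) (sq_nonneg (e₀ * x ^ 2 - e₂ * y ^ 2))
  rw [h3]
  linarith

/-- The dissipation of `x` carries no factor `w`, while that of `y` carries `w ρ`; completing the
square then needs only `w² ≤ w ρ` and `e² ≤ δ² e'`. -/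
theorem weighted_mul_le_of_le_sq {δ w ρ e e' x y : ℝ} (hδ : 0 < δ) (hw : 0 ≤ w) (hwρ : w ≤ ρ)
    (he : 0 ≤ e) (hee' : e ≤ e') (heδ : e ≤ δ ^ 2) :
    w * e * x * y ≤ 1 / 2 * (δ * x ^ 2 + w * ρ * δ * (e' * y ^ 2)) := by
  have hρ : 0 ≤ ρ := hw.trans hwρ
  have he' : 0 ≤ e' := he.trans hee'
  have h1 : 0 ≤ (δ * x - w * e * y) ^ 2 / δ := by positivity
  have h2 : (δ * x - w * e * y) ^ 2 / δ =
      δ * x ^ 2 - 2 * (w * e * x * y) + (w * e * y) ^ 2 / δ := by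
    field_simp
    ring
  have h3 : (w * e * y) ^ 2 / δ ≤ w * ρ * δ * (e' * y ^ 2) := by
    rw [div_le_iff₀ hδ]
    calc (w * e * y) ^ 2 = w * w * (e * e) * y ^ 2 := by ring
      _ ≤ w * ρ * (δ ^ 2 * e') * y ^ 2 := by gcongr
      _ = _ := by ring
  linarith

/-- Here `b j` stands for `‖BAʲV‖` and `v` for `‖V‖`. Half of the term `(2/M) b₀²` supplies the
index `0` missing from the corrector sum; the other half absorbs the products with `b₀`. The
neighbour products are small by log-concavity, except that `b_{m+1}` lies outside the Kalman sum: it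
is bounded by `N v`, hence by that sum itself. -/
theorem sum_hypocoercive_le {m : ℕ} {M N c δ : ℝ} (hM : 1 ≤ M) (hN : 0 ≤ N) (hc : 0 < c)
    (hδ0 : 0 < δ) (hδM : δ * (N * m * M) ≤ 1)
    (hδc : δ * (2 * M * (1 + N ^ 2 / (2 * c) + N)) ≤ 1) {ε : ℕ → ℝ} (hεone : ε 0 = 1)
    (hε0 : ∀ j, 0 < ε j) (hεmono : ∀ j ≤ m, ε (j + 1) ≤ ε j) (hεm : ∀ j ≤ m, ε m ≤ ε j)
    (hεsq : ∀ j < m, ε (j + 1) ≤ δ ^ 2)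
    (hεcon : ∀ j < m, ε (j + 1) ^ 2 = δ ^ 2 * (ε j * ε (j + 2)))
    {w ρ v : ℝ} {b : ℕ → ℝ} (hw : 0 ≤ w) (hwρ : w ≤ ρ) (hwρ1 : w * ρ ≤ 1) (hb : ∀ j, 0 ≤ b j)
    (hbv : b (m + 1) ≤ N * v) (hK : c * v ^ 2 ≤ ∑ j ∈ Finset.range (m + 1), b j ^ 2) :
    -(2 / M) * b 0 ^ 2 + w * ∑ j ∈ Finset.range m, ε (j + 1) *
        (-ρ * b (j + 1) ^ 2 + ρ * (b j * b (j + 2)) + N * b 0 * (b (j + 1) + b j)) ≤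
      -(ε m * c / (2 * M)) * (w * ρ) * v ^ 2 := by
  have hM0 : 0 < M := by linarith
  have hρ : 0 ≤ ρ := hw.trans hwρ
  have hεb : ∀ j, 0 ≤ ε j * b j ^ 2 := fun j => mul_nonneg (hε0 j).le (sq_nonneg _)
  obtain ⟨S, hS⟩ : ∃ S, S = ∑ j ∈ Finset.range (m + 1), ε j * b j ^ 2 := ⟨_, rfl⟩
  obtain ⟨S₁, hS₁⟩ : ∃ S, S = ∑ j ∈ Finset.range m, ε (j + 1) * b (j + 1) ^ 2 := ⟨_, rfl⟩
  obtain ⟨S₀, hS₀⟩ : ∃ S, S = ∑ j ∈ Finset.range m, ε j * b j ^ 2 := ⟨_, rfl⟩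
  obtain ⟨S₂, hS₂⟩ : ∃ S, S = ∑ j ∈ Finset.range m, ε (j + 2) * b (j + 2) ^ 2 := ⟨_, rfl⟩
  obtain ⟨κ, hκ⟩ : ∃ κ, κ = w * ρ := ⟨_, rfl⟩
  have hκ0 : 0 ≤ κ := hκ ▸ mul_nonneg hw hρ
  have hS0 : 0 ≤ S := hS ▸ Finset.sum_nonneg fun j _ => hεb j
  have hS1' : 0 ≤ S₁ := hS₁ ▸ Finset.sum_nonneg fun j _ => hεb (j + 1)
  have hSm : ε m * (c * v ^ 2) ≤ S := by
    refine (mul_le_mul_of_nonneg_left hK (hε0 m).le).trans ?_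
    rw [Finset.mul_sum, hS]
    refine Finset.sum_le_sum fun j hj => ?_
    exact mul_le_mul_of_nonneg_right (hεm j (by simpa [Nat.lt_succ_iff] using hj)) (sq_nonneg _)
  have hS1 : S = S₁ + b 0 ^ 2 := by
    rw [hS, hS₁, Finset.sum_range_succ', hεone, one_mul]
  have hS0S : S₀ ≤ S := by
    rw [hS, hS₀, Finset.sum_range_succ]
    linarith [hεb m]
  have hS1S : S₁ ≤ S := by rw [hS1]; linarith [sq_nonneg (b 0)]
  have hS2S : S₂ ≤ S + N ^ 2 / c * S := by
    have hlast : ε (m + 1) * b (m + 1) ^ 2 ≤ N ^ 2 / c * S := by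
      calc ε (m + 1) * b (m + 1) ^ 2 ≤ ε m * (N * v) ^ 2 :=
            mul_le_mul (hεmono m le_rfl) (pow_le_pow_left₀ (hb _) hbv 2) (sq_nonneg _) (hε0 m).le
        _ = N ^ 2 / c * (ε m * (c * v ^ 2)) := by field_simp
        _ ≤ N ^ 2 / c * S := by gcongr
    have h1 : ∑ j ∈ Finset.range (m + 1), ε (j + 1) * b (j + 1) ^ 2 =
        S₁ + ε (m + 1) * b (m + 1) ^ 2 := by rw [Finset.sum_range_succ, hS₁]
    have h2 : ∑ j ∈ Finset.range (m + 1), ε (j + 1) * b (j + 1) ^ 2 =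
        S₂ + ε 1 * b 1 ^ 2 := by rw [Finset.sum_range_succ', hS₂]
    linarith [hεb 1]
  have hterm : ∀ j ∈ Finset.range m, w * (ε (j + 1) *
      (-ρ * b (j + 1) ^ 2 + ρ * (b j * b (j + 2)) + N * b 0 * (b (j + 1) + b j))) ≤
      -κ * (ε (j + 1) * b (j + 1) ^ 2) +
      κ * (δ / 2) * (ε j * b j ^ 2 + ε (j + 2) * b (j + 2) ^ 2) +
      N * (δ * b 0 ^ 2) +
      κ * (N * δ / 2) * (ε (j + 1) * b (j + 1) ^ 2 + ε j * b j ^ 2) := by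
    intro j hj
    have hj := Finset.mem_range.1 hj
    have h1 := weighted_mul_le_of_sq_eq (x := b j) (y := b (j + 2)) hδ0.le (hε0 j).le
      (hε0 (j + 2)).le (hεcon j hj)
    have h6 := weighted_mul_le_of_le_sq (x := b 0) (y := b (j + 1)) hδ0 hw hwρ (hε0 (j + 1)).le
      le_rfl (hεsq j hj)
    have h7 := weighted_mul_le_of_le_sq (x := b 0) (y := b j) hδ0 hw hwρ (hε0 (j + 1)).le
      (hεmono j hj.le) (hεsq j hj)
    have h8 := mul_le_mul_of_nonneg_left h1 (mul_nonneg hw hρ)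
    have h9 := mul_le_mul_of_nonneg_left (add_le_add h6 h7) hN
    rw [hκ]
    linarith
  have hsum := Finset.sum_le_sum hterm
  rw [← Finset.mul_sum] at hsum
  simp only [Finset.sum_add_distrib, ← Finset.mul_sum, Finset.sum_const, Finset.card_range,
    nsmul_eq_mul] at hsum
  rw [← hS₁, ← hS₀, ← hS₂] at hsum
  rw [← hκ] at hwρ1 ⊢
  have hA : κ * (δ / 2) * (S₀ + S₂) ≤ κ * (δ / 2) * (S + (S + N ^ 2 / c * S)) := by gcongr
  have hB : κ * (N * δ / 2) * (S₁ + S₀) ≤ κ * (N * δ / 2) * (S + S) := by gcongr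
  have hM1 : 1 / M ≤ 1 := by rw [div_le_one hM0]; exact hM
  have hC : -κ * S₁ ≤ -(1 / M) * κ * S + 1 / M * b 0 ^ 2 := by
    have h1 : 1 / M * (κ * S₁) ≤ κ * S₁ := mul_le_of_le_one_left (by positivity) hM1
    have h2 : 1 / M * (κ * b 0 ^ 2) ≤ 1 / M * b 0 ^ 2 :=
      mul_le_mul_of_nonneg_left (mul_le_of_le_one_left (sq_nonneg _) hwρ1) (by positivity)
    rw [hS1]
    linarith
  have hD : m * (N * (δ * b 0 ^ 2)) ≤ 1 / M * b 0 ^ 2 := by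
    have : m * N * δ ≤ 1 / M := by rw [le_div_iff₀ hM0]; linarith
    calc m * (N * (δ * b 0 ^ 2)) = m * N * δ * b 0 ^ 2 := by ring
      _ ≤ _ := mul_le_mul_of_nonneg_right this (sq_nonneg _)
  have hE : δ * (1 + N ^ 2 / (2 * c) + N) * (κ * S) ≤ 1 / (2 * M) * (κ * S) := by
    refine mul_le_mul_of_nonneg_right ?_ (by positivity)
    rw [le_div_iff₀ (by positivity)]
    linarith
  have hF : ε m * c / (2 * M) * κ * v ^ 2 ≤ 1 / (2 * M) * (κ * S) := by
    calc ε m * c / (2 * M) * κ * v ^ 2 = 1 / (2 * M) * (κ * (ε m * (c * v ^ 2))) := by ring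
      _ ≤ _ := by gcongr
  have hG : κ * (δ / 2) * (S + (S + N ^ 2 / c * S)) + κ * (N * δ / 2) * (S + S) =
      δ * (1 + N ^ 2 / (2 * c) + N) * (κ * S) := by field_simp; ring
  have hH : (1 / M) * κ * S = 2 * (1 / (2 * M) * (κ * S)) := by field_simp
  have hI : 2 / M * b 0 ^ 2 = 1 / M * b 0 ^ 2 + 1 / M * b 0 ^ 2 := by ring
  linarith

theorem exists_hypocoercive_weights (m : ℕ) {M N c : ℝ} (hM : 1 ≤ M) (hN : 0 ≤ N) (hc : 0 < c) :
    ∃ (ε : ℕ → ℝ) (η : ℝ), 0 < η ∧ (∀ j, 0 < ε j) ∧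
      (∑ j ∈ Finset.range m, ε (j + 1)) * N ^ 2 ≤ 1 / 2 ∧
      ∀ (w ρ v : ℝ) (b : ℕ → ℝ), 0 ≤ w → w ≤ ρ → w * ρ ≤ 1 → (∀ j, 0 ≤ b j) →
        b (m + 1) ≤ N * v → c * v ^ 2 ≤ ∑ j ∈ Finset.range (m + 1), b j ^ 2 →
        -(2 / M) * b 0 ^ 2 + w * ∑ j ∈ Finset.range m, ε (j + 1) *
            (-ρ * b (j + 1) ^ 2 + ρ * (b j * b (j + 2)) + N * b 0 * (b (j + 1) + b j)) ≤
          -η * (w * ρ) * v ^ 2 := by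
  have hM0 : 0 < M := by linarith
  -- `δ` has to be small against three quantities: `q₁` for the products with `b₀`, `q₂` for the
  -- cross terms, and `q₃` so that the corrector is at most half of the energy.
  obtain ⟨q₁, hq₁⟩ : ∃ x, x = N * m * M := ⟨_, rfl⟩
  obtain ⟨q₂, hq₂⟩ : ∃ x, x = 2 * M * (1 + N ^ 2 / (2 * c) + N) := ⟨_, rfl⟩
  obtain ⟨q₃, hq₃⟩ : ∃ x, x = 2 * m * N ^ 2 := ⟨_, rfl⟩
  have h1 : 0 ≤ q₁ := by rw [hq₁]; positivity
  have h2 : 0 ≤ q₂ := by rw [hq₂]; positivity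
  have h3 : 0 ≤ q₃ := by rw [hq₃]; positivity
  have hQ : 0 < 1 + q₁ + q₂ + q₃ := by positivity
  obtain ⟨δ, hδ⟩ : ∃ δ, δ = 1 / (1 + q₁ + q₂ + q₃) := ⟨_, rfl⟩
  have hδ0 : 0 < δ := by rw [hδ]; positivity
  have hle : ∀ x, x ≤ 1 + q₁ + q₂ + q₃ → δ * x ≤ 1 := fun x hx => by
    rw [hδ, one_div_mul_eq_div, div_le_one hQ]; exact hx
  have hδ1 : δ ≤ 1 := by simpa using hle 1 (by linarith)
  obtain ⟨ε, e1, e2, e3, e4, e5, e6⟩ := exists_logConcave_weights m hδ0 hδ1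
  refine ⟨ε, ε m * c / (2 * M), by have := e2 m; positivity, e2, ?_,
    fun w ρ v b hw hwρ hwρ1 hb hbv hK => sum_hypocoercive_le hM hN hc hδ0
      (by rw [← hq₁]; exact hle _ (by linarith)) (by rw [← hq₂]; exact hle _ (by linarith))
      e1 e2 e3 e4 e5 e6 hw hwρ hwρ1 hb hbv hK⟩
  have h4 : ∑ j ∈ Finset.range m, ε (j + 1) ≤ m * δ := by
    have : ∀ j ∈ Finset.range m, ε (j + 1) ≤ δ := fun j hj =>
      (e5 j (Finset.mem_range.1 hj)).trans (by nlinarith)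
    refine (Finset.sum_le_sum this).trans ?_
    simp
  have h5 := hle q₃ (by linarith)
  rw [hq₃] at h5
  calc _ ≤ m * δ * N ^ 2 := by gcongr
    _ ≤ 1 / 2 := by linarith

/-- Families of bounded operators `A`, `B` in a complex Hilbert space with `O(1 / (1 + t))`
derivatives `A'`, `B'`, where `A` is symmetric and `B` is nonnegative. -/
structure DissipativeFamily {H : Type*} [NormedAddCommGroup H] [InnerProductSpace ℂ H] (M : ℝ)
    (A B A' B' : ℝ → H →L[ℝ] H) : Prop where
  hasDeriv_A : ∀ t, 0 ≤ t → HasDerivWithinAt A (A' t) (Ici 0) t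
  hasDeriv_B : ∀ t, 0 ≤ t → HasDerivWithinAt B (B' t) (Ici 0) t
  norm_A : ∀ t, 0 ≤ t → ‖A t‖ ≤ M
  norm_B : ∀ t, 0 ≤ t → ‖B t‖ ≤ M
  norm_A' : ∀ t, 0 ≤ t → ‖A' t‖ ≤ M / (1 + t)
  norm_B' : ∀ t, 0 ≤ t → ‖B' t‖ ≤ M / (1 + t)
  A_I_smul : ∀ t, 0 ≤ t → ∀ x, A t (Complex.I • x) = Complex.I • A t x
  B_I_smul : ∀ t, 0 ≤ t → ∀ x, B t (Complex.I • x) = Complex.I • B t x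
  A_symm : ∀ t, 0 ≤ t → ∀ x, (inner ℂ x (A t x)).im = 0
  B_nonneg : ∀ t, 0 ≤ t → ∀ x, ‖B t x‖ ^ 2 ≤ M * (inner ℂ x (B t x)).re

namespace DissipativeFamily

variable {H : Type*} [NormedAddCommGroup H] [InnerProductSpace ℂ H] {M : ℝ}
  {A B A' B' : ℝ → H →L[ℝ] H}

theorem norm_mul_pow_le (h : DissipativeFamily M A B A' B') (hM : 1 ≤ M) (j : ℕ) {t : ℝ}
    (ht : 0 ≤ t) : ‖B t * A t ^ j‖ ≤ M ^ (j + 1) := by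
  induction j with
  | zero => simpa using h.norm_B t ht
  | succ j ih =>
    rw [pow_succ, ← mul_assoc]
    refine (norm_mul_le _ _).trans ?_
    rw [pow_succ M (j + 1)]
    have := h.norm_A t ht
    gcongr

theorem exists_hasDerivWithinAt_mul_pow (h : DissipativeFamily M A B A' B') (hM : 1 ≤ M) (j : ℕ)
    {t : ℝ} (ht : 0 ≤ t) :
    ∃ P', HasDerivWithinAt (fun s => B s * A s ^ j) P' (Ici 0) t ∧
      ‖P'‖ ≤ (j + 1) * M ^ (j + 1) / (1 + t) := by
  induction j with
  | zero => exact ⟨B' t, by simpa using h.hasDeriv_B t ht, by simpa using h.norm_B' t ht⟩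
  | succ j ih =>
    obtain ⟨P', hP', hn⟩ := ih
    refine ⟨P' * A t + B t * A t ^ j * A' t, ?_, ?_⟩
    · have := hP'.mul (h.hasDeriv_A t ht)
      simpa only [pow_succ, mul_assoc] using! this
    · have h1 : ‖P' * A t‖ ≤ (j + 1) * M ^ (j + 1) / (1 + t) * M :=
        (norm_mul_le _ _).trans (mul_le_mul hn (h.norm_A t ht) (norm_nonneg _) (by positivity))
      have h2 : ‖B t * A t ^ j * A' t‖ ≤ M ^ (j + 1) * (M / (1 + t)) :=
        (norm_mul_le _ _).trans (mul_le_mul (h.norm_mul_pow_le hM j ht) (h.norm_A' t ht)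
          (norm_nonneg _) (by positivity))
      refine (norm_add_le _ _).trans ((add_le_add h1 h2).trans (le_of_eq ?_))
      push_cast
      field_simp
      ring

theorem pow_I_smul (h : DissipativeFamily M A B A' B') (j : ℕ) {t : ℝ} (ht : 0 ≤ t) (x : H) :
    (B t * A t ^ j) (Complex.I • x) = Complex.I • (B t * A t ^ j) x := by
  have h1 : ∀ x, (A t ^ j) (Complex.I • x) = Complex.I • (A t ^ j) x := by
    induction j with
    | zero => simp
    | succ j ih =>
      intro x
      rw [pow_succ, mul_apply_eq_comp, h.A_I_smul t ht, ih,
        mul_apply_eq_comp]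
  rw [mul_apply_eq_comp, h1, h.B_I_smul t ht, mul_apply_eq_comp]

end DissipativeFamily

/-! ### Energy identity, correctors and the Lyapunov functional -/

section

variable {H : Type*} [NormedAddCommGroup H] [InnerProductSpace ℂ H]

theorem im_inner_le_norm_mul_norm (x y : H) : (inner ℂ x y).im ≤ ‖x‖ * ‖y‖ :=
  (Complex.abs_im_le_norm _).trans (norm_inner_le_norm x y) |> (le_abs_self _).trans

/-- With `p, q, r = BAʲV, BAʲ⁺¹V, BAʲ⁺²V`, the gain is `Im⟨iρq, q⟩ = -ρ‖q‖²`; everything else is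
estimated by Cauchy–Schwarz. -/
theorem im_inner_commutator_le {ρ : ℝ} (hρ : 0 ≤ ρ) (p q r p' q' pb qb : H) :
    (inner ℂ p (q' + (ρ • Complex.I • r - qb))).im +
        (inner ℂ (p' + (ρ • Complex.I • q - pb)) q).im ≤
      -ρ * ‖q‖ ^ 2 + ρ * (‖p‖ * ‖r‖) + (‖p‖ * ‖qb‖ + ‖pb‖ * ‖q‖) +
        (‖p‖ * ‖q'‖ + ‖p'‖ * ‖q‖) := by
  have h1 : (inner ℂ p (ρ • Complex.I • r)).im ≤ ρ * (‖p‖ * ‖r‖) := by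
    refine (im_inner_le_norm_mul_norm _ _).trans (le_of_eq ?_)
    rw [norm_smul, norm_smul, Complex.norm_I, Real.norm_of_nonneg hρ]
    ring
  have h2 : (inner ℂ (ρ • Complex.I • q) q).im = -ρ * ‖q‖ ^ 2 := by
    rw [← Complex.coe_smul, inner_smul_left, inner_smul_left, inner_self_eq_norm_sq_to_K]
    simp [← Complex.ofReal_pow]
  have h3 := im_inner_le_norm_mul_norm p q'
  have h4 := im_inner_le_norm_mul_norm p' q
  have h5 := im_inner_le_norm_mul_norm p (-qb)
  have h6 := im_inner_le_norm_mul_norm (-pb) q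
  rw [norm_neg] at h5 h6
  rw [sub_eq_add_neg, sub_eq_add_neg, inner_add_right, inner_add_right, inner_add_left,
    inner_add_left]
  simp only [Complex.add_im]
  rw [h2]
  linarith

end

namespace DissipativeFamily

variable {H : Type*} [NormedAddCommGroup H] [InnerProductSpace ℂ H] {M : ℝ}
  {A B A' B' : ℝ → H →L[ℝ] H}

theorem hasDerivWithinAt_normSq (h : DissipativeFamily M A B A' B') {ρ : ℝ} {V : ℝ → H} {t : ℝ}
    (ht : 0 ≤ t)
    (hV : HasDerivWithinAt V (ρ • Complex.I • A t (V t) - B t (V t)) (Ici 0) t) :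
    HasDerivWithinAt (fun s => ‖V s‖ ^ 2) (-2 * (inner ℂ (V t) (B t (V t))).re) (Ici 0) t := by
  have h1 := Complex.reCLM.hasFDerivAt.comp_hasDerivWithinAt t (hV.inner ℂ hV)
  have h2 : (fun s => ‖V s‖ ^ 2) = Complex.reCLM ∘ fun s => inner ℂ (V s) (V s) := by
    ext s
    simp only [Function.comp_apply, Complex.reCLM_apply]
    rw [inner_self_eq_norm_sq_to_K]
    norm_cast
  rw [h2]
  refine h1.congr_deriv ?_
  have h3 : (inner ℂ (V t) (ρ • Complex.I • A t (V t))).re = 0 := by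
    rw [← Complex.coe_smul, inner_smul_right, inner_smul_right]
    simp [h.A_symm t ht]
  have h4 : ∀ z : H, (inner ℂ z (V t)).re = (inner ℂ (V t) z).re := fun z =>
    inner_re_symm (𝕜 := ℂ) z (V t)
  simp only [Complex.reCLM_apply, Complex.add_re]
  rw [h4, inner_sub_right, Complex.sub_re, h3]
  ring

/-- The equation sends `BAʲV` to `iρBAʲ⁺¹V - BAʲBV`; the second term always contains the dissipated
`BV`, and the derivative of the operator `BAʲ` costs `O(1/(1+t))`. A single `N` dominates all the
operator norms involved. -/
theorem exists_hasDerivWithinAt_corrector (h : DissipativeFamily M A B A' B') (hM : 1 ≤ M)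
    {ρ N : ℝ} (hρ : 0 ≤ ρ) {V : ℝ → H} {t : ℝ} (ht : 0 ≤ t) {j : ℕ}
    (hN : (j + 2) * M ^ (j + 2) ≤ N)
    (hV : HasDerivWithinAt V (ρ • Complex.I • A t (V t) - B t (V t)) (Ici 0) t) :
    ∃ D, HasDerivWithinAt
        (fun s => (inner ℂ ((B s * A s ^ j) (V s)) ((B s * A s ^ (j + 1)) (V s))).im) D (Ici 0) t ∧
      D ≤ (-ρ * ‖(B t * A t ^ (j + 1)) (V t)‖ ^ 2 +
          ρ * (‖(B t * A t ^ j) (V t)‖ * ‖(B t * A t ^ (j + 2)) (V t)‖) +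
          N * ‖B t (V t)‖ * (‖(B t * A t ^ (j + 1)) (V t)‖ + ‖(B t * A t ^ j) (V t)‖)) +
        2 * N ^ 2 / (1 + t) * ‖V t‖ ^ 2 := by
  obtain ⟨P', hP', hPn⟩ := h.exists_hasDerivWithinAt_mul_pow hM j ht
  obtain ⟨Q', hQ', hQn⟩ := h.exists_hasDerivWithinAt_mul_pow hM (j + 1) ht
  have hp := hP'.clm_apply hV
  have hq := hQ'.clm_apply hV
  refine ⟨_, Complex.imCLM.hasFDerivAt.comp_hasDerivWithinAt t (hp.inner ℂ hq), ?_⟩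
  have hstep : ∀ k, (B t * A t ^ k) (ρ • Complex.I • A t (V t) - B t (V t)) =
      ρ • Complex.I • (B t * A t ^ (k + 1)) (V t) - (B t * A t ^ k) (B t (V t)) := by
    intro k
    rw [map_sub, map_smul, h.pow_I_smul k ht, pow_succ, ← mul_assoc]
    rfl
  have hmon : M ^ (j + 1) ≤ M ^ (j + 2) := pow_le_pow_right₀ hM (by omega)
  have hM2 : 0 < M ^ (j + 2) := by positivity
  have hj : (0 : ℝ) ≤ j := by positivity
  have hN2 : M ^ (j + 2) ≤ N := by nlinarith
  have hN0 : 0 ≤ N := hM2.le.trans hN2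
  have ht1 : 0 < 1 + t := by linarith
  have hPN : ‖B t * A t ^ j‖ ≤ N := (h.norm_mul_pow_le hM j ht).trans (hmon.trans hN2)
  have hQN : ‖B t * A t ^ (j + 1)‖ ≤ N := (h.norm_mul_pow_le hM (j + 1) ht).trans hN2
  have hPN' : ‖P'‖ ≤ N / (1 + t) := by
    refine hPn.trans ?_
    gcongr
    nlinarith
  have hQN' : ‖Q'‖ ≤ N / (1 + t) := by
    refine hQn.trans ?_
    gcongr
    push_cast
    linarith
  have hcom := im_inner_commutator_le hρ ((B t * A t ^ j) (V t)) ((B t * A t ^ (j + 1)) (V t))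
    ((B t * A t ^ (j + 2)) (V t)) (P' (V t)) (Q' (V t)) ((B t * A t ^ j) (B t (V t)))
    ((B t * A t ^ (j + 1)) (B t (V t)))
  simp only [Complex.imCLM_apply, Complex.add_im]
  rw [hstep, hstep]
  refine hcom.trans ?_
  have e1 : ‖(B t * A t ^ j) (B t (V t))‖ ≤ N * ‖B t (V t)‖ :=
    ContinuousLinearMap.le_of_opNorm_le _ hPN _
  have e2 : ‖(B t * A t ^ (j + 1)) (B t (V t))‖ ≤ N * ‖B t (V t)‖ :=
    ContinuousLinearMap.le_of_opNorm_le _ hQN _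
  have e3 : ‖(B t * A t ^ j) (V t)‖ ≤ N * ‖V t‖ := ContinuousLinearMap.le_of_opNorm_le _ hPN _
  have e4 : ‖(B t * A t ^ (j + 1)) (V t)‖ ≤ N * ‖V t‖ := ContinuousLinearMap.le_of_opNorm_le _ hQN _
  have e5 : ‖P' (V t)‖ ≤ N / (1 + t) * ‖V t‖ := ContinuousLinearMap.le_of_opNorm_le _ hPN' _
  have e6 : ‖Q' (V t)‖ ≤ N / (1 + t) * ‖V t‖ := ContinuousLinearMap.le_of_opNorm_le _ hQN' _
  have f1 := mul_le_mul_of_nonneg_left e2 (norm_nonneg ((B t * A t ^ j) (V t)))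
  have f2 := mul_le_mul_of_nonneg_right e1 (norm_nonneg ((B t * A t ^ (j + 1)) (V t)))
  have f3 := mul_le_mul e3 e6 (norm_nonneg _) (by positivity)
  have f4 := mul_le_mul e5 e4 (norm_nonneg _) (by positivity)
  have f5 : N * ‖V t‖ * (N / (1 + t) * ‖V t‖) + N / (1 + t) * ‖V t‖ * (N * ‖V t‖) =
      2 * N ^ 2 / (1 + t) * ‖V t‖ ^ 2 := by field_simp; ring
  linarith

theorem norm_sq_antitone (h : DissipativeFamily M A B A' B') (hM : 1 ≤ M) {ρ : ℝ} {V : ℝ → H}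
    (hV : ∀ t, 0 ≤ t →
      HasDerivWithinAt V (ρ • Complex.I • A t (V t) - B t (V t)) (Ici 0) t) :
    AntitoneOn (fun s => ‖V s‖ ^ 2) (Ici 0) := by
  refine antitoneOn_of_hasDerivWithinAt_nonpos (convex_Ici 0)
    (fun t ht => (h.hasDerivWithinAt_normSq ht (hV t ht)).continuousWithinAt)
    (f' := fun t => -2 * (inner ℂ (V t) (B t (V t))).re) ?_ ?_
  · intro t ht
    have ht := interior_subset ht
    exact (h.hasDerivWithinAt_normSq ht (hV t ht)).mono interior_subset
  · intro t ht
    have ht := interior_subset ht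
    have h1 := h.B_nonneg t ht (V t)
    have h2 : 0 ≤ (inner ℂ (V t) (B t (V t))).re := by
      by_contra hneg
      push Not at hneg
      nlinarith [sq_nonneg ‖B t (V t)‖]
    linarith

/-- The uniform decay estimate under the Kalman condition. -/
theorem exists_decay (m : ℕ) {M c t₀ : ℝ} (hM : 1 ≤ M) (hc : 0 < c) (ht₀ : 0 ≤ t₀) :
    ∃ C γ : ℝ, 0 < C ∧ 0 < γ ∧ ∀ {H : Type} [NormedAddCommGroup H] [InnerProductSpace ℂ H]
      (A B A' B' : ℝ → H →L[ℝ] H) (_ : DissipativeFamily M A B A' B')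
      (_ : ∀ t, t₀ ≤ t → ∀ x, c * ‖x‖ ^ 2 ≤
        ∑ j ∈ Finset.range (m + 1), ‖(B t * A t ^ j) x‖ ^ 2)
      (ρ : ℝ) (V : ℝ → H), 0 < ρ →
      (∀ t, 0 ≤ t → HasDerivWithinAt V (ρ • Complex.I • A t (V t) - B t (V t)) (Ici 0) t) →
      ∀ t, 0 ≤ t → ‖V t‖ ^ 2 ≤ C * Real.exp (-γ * (ρ ^ 2 / (1 + ρ ^ 2)) * t) * ‖V 0‖ ^ 2 := by
  obtain ⟨N, hN⟩ : ∃ N : ℝ, N = (m + 2) * M ^ (m + 2) := ⟨_, rfl⟩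
  have hM0 : 0 < M := by linarith
  have hN0 : 0 < N := by rw [hN]; positivity
  obtain ⟨ε, η, hη, hε, hεN, hform⟩ := exists_hypocoercive_weights m hM hN0.le hc
  -- The factor `3` compares the bounds `‖V‖² ≤ 2L ≤ 3‖V‖²`; the exponential pays for the waiting
  -- time `t₁`, since `κ t₁ ≤ t₀ + 2/η` uniformly in `ρ`.
  refine ⟨3 * Real.exp (η / 3 * (t₀ + 2 / η)), η / 3, by positivity, by positivity, ?_⟩
  intro H _ _ A B A' B' h hK ρ V hρ hV
  -- Comparable to `min(ρ, 1/ρ)`: at low frequency the corrector must be small to be dominated by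
  -- the dissipation, at high frequency its derivative already has the factor `ρ`. The product `w ρ`
  -- is the decay rate.
  obtain ⟨w, hw⟩ : ∃ w, w = ρ / (1 + ρ ^ 2) := ⟨_, rfl⟩
  have hw0 : 0 < w := by rw [hw]; positivity
  have hwρ : w ≤ ρ := by rw [hw]; exact div_le_self hρ.le (by nlinarith)
  have hw1 : w ≤ 1 := by rw [hw, div_le_one (by positivity)]; nlinarith [sq_nonneg (ρ - 1)]
  have hwρ' : w * ρ = ρ ^ 2 / (1 + ρ ^ 2) := by rw [hw]; ring
  have hwρ1 : w * ρ ≤ 1 := by rw [hwρ', div_le_one (by positivity)]; linarith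
  rw [← hwρ']
  obtain ⟨κ, hκ⟩ : ∃ κ, κ = w * ρ := ⟨_, rfl⟩
  have hκ0 : 0 < κ := hκ ▸ mul_pos hw0 hρ
  have hNj : ∀ j ≤ m, (j + 2 : ℝ) * M ^ (j + 2) ≤ N := by
    intro j hj
    rw [hN]
    gcongr
  have hbN : ∀ j ≤ m + 1, ∀ t, 0 ≤ t → ∀ x, ‖(B t * A t ^ j) x‖ ≤ N * ‖x‖ := by
    intro j hj t ht x
    refine ContinuousLinearMap.le_of_opNorm_le _ ((h.norm_mul_pow_le hM j ht).trans ?_) _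
    calc M ^ (j + 1) ≤ M ^ (m + 2) := pow_le_pow_right₀ hM (by omega)
      _ ≤ N := by
        rw [hN]
        exact le_mul_of_one_le_left (by positivity) (by
          have : (0 : ℝ) ≤ m := by positivity
          linarith)
  obtain ⟨f, hf⟩ : ∃ f : ℕ → ℝ → ℝ, f = fun j s =>
    (inner ℂ ((B s * A s ^ j) (V s)) ((B s * A s ^ (j + 1)) (V s))).im := ⟨_, rfl⟩
  have hfle : ∀ j ∈ Finset.range m, ∀ t, 0 ≤ t → |f j t| ≤ N ^ 2 * ‖V t‖ ^ 2 := by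
    intro j hj t ht
    have hj := Finset.mem_range.1 hj
    rw [hf]
    refine (Complex.abs_im_le_norm _).trans ((norm_inner_le_norm _ _).trans ?_)
    calc _ ≤ (N * ‖V t‖) * (N * ‖V t‖) := by
          gcongr
          · exact hbN j (by omega) t ht _
          · exact hbN (j + 1) (by omega) t ht _
      _ = _ := by ring
  obtain ⟨L, hL⟩ : ∃ L : ℝ → ℝ, L = fun s =>
    ‖V s‖ ^ 2 + w * ∑ j ∈ Finset.range m, ε (j + 1) * f j s := ⟨_, rfl⟩
  have hcor : ∀ t, 0 ≤ t → |w * ∑ j ∈ Finset.range m, ε (j + 1) * f j t| ≤ 1 / 2 * ‖V t‖ ^ 2 := by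
    intro t ht
    rw [abs_mul, abs_of_pos hw0]
    have h1 : |∑ j ∈ Finset.range m, ε (j + 1) * f j t| ≤
        (∑ j ∈ Finset.range m, ε (j + 1)) * N ^ 2 * ‖V t‖ ^ 2 := by
      refine (Finset.abs_sum_le_sum_abs _ _).trans ?_
      rw [mul_assoc, Finset.sum_mul]
      refine Finset.sum_le_sum fun j hj => ?_
      rw [abs_mul, abs_of_pos (hε _)]
      exact mul_le_mul_of_nonneg_left (hfle j hj t ht) (hε _).le
    calc _ ≤ 1 * |∑ j ∈ Finset.range m, ε (j + 1) * f j t| := by gcongr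
      _ ≤ 1 / 2 * ‖V t‖ ^ 2 := by
        rw [one_mul]
        exact h1.trans (mul_le_mul_of_nonneg_right hεN (sq_nonneg _))
  have hLlo : ∀ t, 0 ≤ t → ‖V t‖ ^ 2 ≤ 2 * L t := fun t ht => by
    have := (abs_le.1 (hcor t ht)).1
    rw [hL]
    linarith
  have hLup : ∀ t, 0 ≤ t → 2 * L t ≤ 3 * ‖V t‖ ^ 2 := fun t ht => by
    have := (abs_le.1 (hcor t ht)).2
    rw [hL]
    linarith
  -- From `t₀` on the Kalman bound is available, and from `2/(ηρ)` on the `O(1/(1+t))` error takes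
  -- at most half of the coercive term `ηκ‖V‖²`.
  have hLder : ∀ t, max t₀ (2 / (η * ρ)) ≤ t → ∃ D, HasDerivWithinAt L D (Ici 0) t ∧
      D ≤ -(η / 3 * κ) * L t := by
    intro t ht
    have ht0 : t₀ ≤ t := (le_max_left _ _).trans ht
    have htρ : 2 / (η * ρ) ≤ t := (le_max_right _ _).trans ht
    have htn : 0 ≤ t := ht₀.trans ht0
    have hcd : ∀ j, ∃ D, j ∈ Finset.range m → HasDerivWithinAt (f j) D (Ici 0) t ∧
      D ≤ (-ρ * ‖(B t * A t ^ (j + 1)) (V t)‖ ^ 2 +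
          ρ * (‖(B t * A t ^ j) (V t)‖ * ‖(B t * A t ^ (j + 2)) (V t)‖) +
          N * ‖B t (V t)‖ * (‖(B t * A t ^ (j + 1)) (V t)‖ + ‖(B t * A t ^ j) (V t)‖)) +
        2 * N ^ 2 / (1 + t) * ‖V t‖ ^ 2 := by
      intro j
      by_cases hj : j ∈ Finset.range m
      · obtain ⟨D, hD⟩ := h.exists_hasDerivWithinAt_corrector hM hρ.le htn
          (hNj j (Finset.mem_range.1 hj).le) (hV t htn)
        exact ⟨D, fun _ => by rw [hf]; exact hD⟩
      · exact ⟨0, fun h => absurd h hj⟩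
    choose D hD using hcd
    refine ⟨_, by
      rw [hL]
      exact (h.hasDerivWithinAt_normSq htn (hV t htn)).add ((HasDerivWithinAt.fun_sum
        (fun j hj => (hD j hj).1.const_mul (ε (j + 1)))).const_mul w), ?_⟩
    have hmain := hform w ρ ‖V t‖ (fun j => ‖(B t * A t ^ j) (V t)‖) hw0.le hwρ hwρ1
      (fun j => norm_nonneg _) (hbN (m + 1) le_rfl t htn _) (hK t ht0 _)
    simp only [pow_zero, mul_one] at hmain
    have hsum : ∑ j ∈ Finset.range m, ε (j + 1) * D j ≤
        ∑ j ∈ Finset.range m, ε (j + 1) * (-ρ * ‖(B t * A t ^ (j + 1)) (V t)‖ ^ 2 +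
          ρ * (‖(B t * A t ^ j) (V t)‖ * ‖(B t * A t ^ (j + 2)) (V t)‖) +
          N * ‖B t (V t)‖ * (‖(B t * A t ^ (j + 1)) (V t)‖ + ‖(B t * A t ^ j) (V t)‖)) +
        (∑ j ∈ Finset.range m, ε (j + 1)) * (2 * N ^ 2 / (1 + t) * ‖V t‖ ^ 2) := by
      rw [Finset.sum_mul, ← Finset.sum_add_distrib]
      refine Finset.sum_le_sum fun j hj => ?_
      rw [← mul_add]
      exact mul_le_mul_of_nonneg_left (hD j hj).2 (hε _).le
    have hBn := h.B_nonneg t htn (V t)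
    have hB2 : -2 * (inner ℂ (V t) (B t (V t))).re ≤ -(2 / M) * ‖B t (V t)‖ ^ 2 := by
      have : ‖B t (V t)‖ ^ 2 / M ≤ (inner ℂ (V t) (B t (V t))).re := by
        rw [div_le_iff₀ hM0]; linarith
      have h2 : 2 / M * ‖B t (V t)‖ ^ 2 = 2 * (‖B t (V t)‖ ^ 2 / M) := by ring
      linarith
    have ht1 : 0 < 1 + t := by linarith
    have herr : w * ((∑ j ∈ Finset.range m, ε (j + 1)) * (2 * N ^ 2 / (1 + t) * ‖V t‖ ^ 2)) ≤
        η / 2 * κ * ‖V t‖ ^ 2 := by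
      have h3 : 1 / (1 + t) ≤ η / 2 * ρ := by
        rw [div_le_iff₀ ht1]
        rw [div_le_iff₀ (by positivity)] at htρ
        have : 0 < η * ρ := by positivity
        nlinarith
      calc _ = w * (2 * ((∑ j ∈ Finset.range m, ε (j + 1)) * N ^ 2) * (1 / (1 + t))) *
            ‖V t‖ ^ 2 := by ring
        _ ≤ w * (2 * (1 / 2) * (η / 2 * ρ)) * ‖V t‖ ^ 2 := by gcongr
        _ = _ := by rw [hκ]; ring
    have hwsum := mul_le_mul_of_nonneg_left hsum hw0.le
    rw [mul_add] at hwsum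
    rw [← hκ] at hmain
    have hfin : η / 2 * κ * ‖V t‖ ^ 2 ≥ η / 3 * κ * L t := by
      have := mul_le_mul_of_nonneg_left (hLup t htn) (by positivity : 0 ≤ η / 6 * κ)
      linarith
    linarith
  obtain ⟨t₁, ht₁⟩ : ∃ t₁, t₁ = max t₀ (2 / (η * ρ)) := ⟨_, rfl⟩
  have ht₁0 : 0 ≤ t₁ := ht₁ ▸ ht₀.trans (le_max_left _ _)
  rw [← ht₁] at hLder
  choose! D hLD hLDle using hLder
  have hanti := h.norm_sq_antitone hM hV
  have hκt : κ * t₁ ≤ t₀ + 2 / η := by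
    have h1 : t₁ ≤ t₀ + 2 / (η * ρ) := by
      rw [ht₁]
      exact max_le (by have : 0 < 2 / (η * ρ) := by positivity
                       linarith) (by linarith)
    calc κ * t₁ ≤ κ * (t₀ + 2 / (η * ρ)) := by gcongr
      _ = κ * t₀ + w * (2 / η) := by rw [hκ]; field_simp
      _ ≤ 1 * t₀ + 1 * (2 / η) := by
        gcongr
        rw [hκ]; exact hwρ1
      _ = _ := by ring
  have hexp : ∀ t, Real.exp (-(η / 3) * κ * (t - t₁)) ≤
      Real.exp (η / 3 * (t₀ + 2 / η)) * Real.exp (-(η / 3) * κ * t) := by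
    intro t
    rw [← Real.exp_add]
    refine Real.exp_le_exp.2 ?_
    have := mul_le_mul_of_nonneg_left hκt (by positivity : 0 ≤ η / 3)
    linarith
  intro t ht
  rw [← hκ]
  -- Up to `t₁` monotonicity of the energy suffices, the stated bound being at least `‖V 0‖²` there;
  -- afterwards Grönwall for `L` applies.
  rcases le_or_gt t t₁ with htt | htt
  · have h1 : ‖V t‖ ^ 2 ≤ ‖V 0‖ ^ 2 := hanti (mem_Ici.2 le_rfl) (mem_Ici.2 ht) ht
    have h2 : 1 ≤ Real.exp (-(η / 3) * κ * (t - t₁)) := by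
      refine Real.one_le_exp ?_
      have : 0 ≤ η / 3 * κ * (t₁ - t) := mul_nonneg (by positivity) (by linarith)
      linarith
    have h3 : 1 ≤ 3 * Real.exp (η / 3 * (t₀ + 2 / η)) * Real.exp (-(η / 3) * κ * t) := by
      have := hexp t
      linarith
    calc ‖V t‖ ^ 2 ≤ 1 * ‖V 0‖ ^ 2 := by rw [one_mul]; exact h1
      _ ≤ _ := by gcongr
  · have hg : AntitoneOn (fun s => Real.exp (η / 3 * κ * s) * L s) (Ici t₁) := by
      have hder : ∀ s, t₁ ≤ s → HasDerivWithinAt (fun s => Real.exp (η / 3 * κ * s) * L s)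
          (Real.exp (η / 3 * κ * s) * (η / 3 * κ * 1) * L s +
            Real.exp (η / 3 * κ * s) * D s) (Ici 0) s := fun s hs =>
        (((hasDerivWithinAt_id s _).const_mul (η / 3 * κ)).exp).mul (hLD s hs)
      have hsub : Ici t₁ ⊆ Ici (0 : ℝ) := Ici_subset_Ici.2 ht₁0
      refine antitoneOn_of_hasDerivWithinAt_nonpos (convex_Ici t₁)
        (fun s hs => ((hder s hs).mono hsub).continuousWithinAt)
        (fun s hs => (hder s (interior_subset hs)).mono (interior_subset.trans hsub)) ?_
      intro s hs
      have h1 := hLDle s (interior_subset hs)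
      have h2 := Real.exp_pos (η / 3 * κ * s)
      have h3 := mul_le_mul_of_nonneg_left h1 h2.le
      linarith
    have h1 := hg (mem_Ici.2 le_rfl) (mem_Ici.2 htt.le) htt.le
    have h2 : L t ≤ Real.exp (-(η / 3) * κ * (t - t₁)) * L t₁ := by
      have h3 := mul_le_mul_of_nonneg_left h1 (Real.exp_pos (-(η / 3 * κ * t))).le
      simp only [← mul_assoc, ← Real.exp_add] at h3
      have e1 : -(η / 3 * κ * t) + η / 3 * κ * t = 0 := by ring
      have e2 : -(η / 3 * κ * t) + η / 3 * κ * t₁ = -(η / 3) * κ * (t - t₁) := by ring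
      rw [e1, e2, Real.exp_zero, one_mul] at h3
      exact h3
    have h4 : ‖V t₁‖ ^ 2 ≤ ‖V 0‖ ^ 2 := hanti (mem_Ici.2 le_rfl) (mem_Ici.2 ht₁0) ht₁0
    have h5 := hLup t₁ ht₁0
    calc ‖V t‖ ^ 2 ≤ 2 * L t := hLlo t ht
      _ ≤ Real.exp (-(η / 3) * κ * (t - t₁)) * (3 * ‖V 0‖ ^ 2) := by
        have := mul_le_mul_of_nonneg_left (h5.trans (mul_le_mul_of_nonneg_left h4 (by norm_num)))
          (Real.exp_pos (-(η / 3) * κ * (t - t₁))).le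
        linarith
      _ ≤ Real.exp (η / 3 * (t₀ + 2 / η)) * Real.exp (-(η / 3) * κ * t) * (3 * ‖V 0‖ ^ 2) := by
        gcongr
        exact hexp t
      _ = _ := by ring

end DissipativeFamily

/-! ### The coefficients as operators -/

theorem TClass.exists_hasDerivWithinAt {f : ℝ → ℂ} (hf : TClass 0 f) :
    ∃ C : ℝ, 0 ≤ C ∧ ∀ t, 0 ≤ t → HasDerivWithinAt f (derivWithin f (Ici 0) t) (Ici 0) t ∧
      ‖f t‖ ≤ C ∧ ‖derivWithin f (Ici 0) t‖ ≤ C / (1 + t) := by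
  obtain ⟨C₀, h0⟩ := hf.2 0
  obtain ⟨C₁, h1⟩ := hf.2 1
  refine ⟨max (max C₀ C₁) 0, le_max_right _ _, fun t ht => ⟨?_, ?_, ?_⟩⟩
  · exact (hf.1.differentiableOn (by simp) t ht).hasDerivWithinAt
  · have := h0 t ht
    simp only [iteratedDerivWithin_zero, add_zero, pow_zero, mul_one] at this
    exact this.trans ((le_max_left _ _).trans (le_max_left _ _))
  · have := h1 t ht
    rw [iteratedDerivWithin_one] at this
    refine this.trans ?_
    simp only [zero_add, pow_one, mul_one_div]
    gcongr
    exact (le_max_right _ _).trans (le_max_left _ _)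

theorem MatTClass.exists_hasDerivWithinAt {d : ℕ} {K : ℝ → Matrix (Fin d) (Fin d) ℂ}
    (hK : MatTClass 0 K) :
    ∃ (K' : ℝ → Cd d →L[ℂ] Cd d) (M : ℝ), 0 ≤ M ∧ ∀ t, 0 ≤ t →
      HasDerivWithinAt (fun s => (Matrix.toEuclideanCLM (𝕜 := ℂ) (K s) : Cd d →L[ℂ] Cd d)) (K' t)
        (Ici 0) t ∧
      ‖(Matrix.toEuclideanCLM (𝕜 := ℂ) (K t) : Cd d →L[ℂ] Cd d)‖ ≤ M ∧ ‖K' t‖ ≤ M / (1 + t) := by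
  choose C hC0 hC using fun i j => (hK i j).exists_hasDerivWithinAt
  let E : Fin d → Fin d → Cd d →L[ℂ] Cd d := fun i j =>
    Matrix.toEuclideanCLM (𝕜 := ℂ) (Matrix.single i j 1)
  have hE : ∀ s, (Matrix.toEuclideanCLM (𝕜 := ℂ) (K s) : Cd d →L[ℂ] Cd d) =
      ∑ i, ∑ j, K s i j • E i j := by
    intro s
    conv_lhs => rw [Matrix.matrix_eq_sum_single (K s)]
    simp only [map_sum]
    refine Finset.sum_congr rfl fun i _ => Finset.sum_congr rfl fun j _ => ?_
    rw [← map_smul, Matrix.smul_single, smul_eq_mul, mul_one]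
  refine ⟨fun t => ∑ i, ∑ j, derivWithin (fun s => K s i j) (Ici 0) t • E i j,
    ∑ i, ∑ j, C i j * ‖E i j‖, by
      refine Finset.sum_nonneg fun i _ => Finset.sum_nonneg fun j _ => ?_
      have := hC0 i j
      positivity, fun t ht => ⟨?_, ?_, ?_⟩⟩
  · simp_rw [hE]
    exact HasDerivWithinAt.fun_sum fun i _ => HasDerivWithinAt.fun_sum fun j _ =>
      (hC i j t ht).1.smul_const (E i j)
  · rw [hE]
    refine (norm_sum_le _ _).trans (Finset.sum_le_sum fun i _ =>
      (norm_sum_le _ _).trans (Finset.sum_le_sum fun j _ => ?_))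
    rw [norm_smul]
    have := (hC i j t ht).2.1
    gcongr
  · refine (norm_sum_le _ _).trans ?_
    rw [Finset.sum_div]
    refine Finset.sum_le_sum fun i _ => (norm_sum_le _ _).trans ?_
    rw [Finset.sum_div]
    refine Finset.sum_le_sum fun j _ => ?_
    rw [norm_smul, mul_div_right_comm]
    have := (hC i j t ht).2.2
    gcongr

theorem symbolA_smul {n d : ℕ} (A : Fin n → ℝ → Matrix (Fin d) (Fin d) ℂ) (t a : ℝ) (ξ : Rn n) :
    symbolA A t (a • ξ) = (a : ℂ) • symbolA A t ξ := by
  simp only [symbolA, Finset.smul_sum, smul_smul, PiLp.smul_apply, smul_eq_mul, Complex.ofReal_mul]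

theorem isHermitian_symbolA {n d : ℕ} {A : Fin n → ℝ → Matrix (Fin d) (Fin d) ℂ} {t : ℝ}
    (hA : ∀ k, (A k t).IsHermitian) (ξ : Rn n) : (symbolA A t ξ).IsHermitian := by
  unfold symbolA
  rw [Matrix.IsHermitian, Matrix.conjTranspose_sum]
  refine Finset.sum_congr rfl fun k _ => ?_
  rw [Matrix.conjTranspose_smul, (hA k).eq]
  simp

theorem im_inner_toEuclideanCLM {d : ℕ} {K : Matrix (Fin d) (Fin d) ℂ} (hK : K.IsHermitian)
    (v : Cd d) : (inner ℂ v ((Matrix.toEuclideanCLM (𝕜 := ℂ) K : Cd d →L[ℂ] Cd d) v)).im = 0 := by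
  have h : IsSelfAdjoint (Matrix.toEuclideanCLM (𝕜 := ℂ) K : Cd d →L[ℂ] Cd d) :=
    (show IsSelfAdjoint K from hK).map _
  have h2 := h.isSymmetric.im_inner_self_apply v
  exact h2

/-- Positivity of the form at `(M - K)v` gives `0 ≤ M²⟨v,Kv⟩ - 2M‖Kv‖² + ⟨Kv,K²v⟩`, whose last term
is at most `M‖Kv‖²`; no square root of `K` is needed. -/
theorem norm_sq_toEuclideanCLM_le {d : ℕ} {K : Matrix (Fin d) (Fin d) ℂ} (hK : K.PosSemidef)
    {M : ℝ} (hM0 : 0 < M) (hM : ‖(Matrix.toEuclideanCLM (𝕜 := ℂ) K : Cd d →L[ℂ] Cd d)‖ ≤ M)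
    (v : Cd d) :
    ‖(Matrix.toEuclideanCLM (𝕜 := ℂ) K : Cd d →L[ℂ] Cd d) v‖ ^ 2 ≤
      M * (inner ℂ v ((Matrix.toEuclideanCLM (𝕜 := ℂ) K : Cd d →L[ℂ] Cd d) v)).re := by
  set T : Cd d →L[ℂ] Cd d := Matrix.toEuclideanCLM (𝕜 := ℂ) K with hT
  have hsa : IsSelfAdjoint T := (show IsSelfAdjoint K from hK.isHermitian).map _
  have hpos : ∀ x : Cd d, 0 ≤ (inner ℂ x (T x)).re := by
    intro x
    have h := hK.re_dotProduct_nonneg x.ofLp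
    rw [EuclideanSpace.inner_eq_star_dotProduct, dotProduct_comm]
    exact h
  have h1 := hpos ((M : ℂ) • v - T v)
  have h2 : (inner ℂ v (T (T v))).re = ‖T v‖ ^ 2 := by
    have := hsa.isSymmetric v (T v)
    simp only [ContinuousLinearMap.coe_coe] at this
    rw [← this, inner_self_eq_norm_sq_to_K]
    norm_cast
  have h3 : (inner ℂ (T v) (T v)).re = ‖T v‖ ^ 2 := by
    rw [inner_self_eq_norm_sq_to_K]
    norm_cast
  have h4 : (inner ℂ (T v) (T (T v))).re ≤ M * ‖T v‖ ^ 2 := by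
    refine (Complex.re_le_norm _).trans ((norm_inner_le_norm _ _).trans ?_)
    have := T.le_of_opNorm_le hM (T v)
    calc _ ≤ ‖T v‖ * (M * ‖T v‖) := by gcongr
      _ = _ := by ring
  simp only [map_sub, map_smul, inner_sub_left, inner_sub_right, inner_smul_left, inner_smul_right,
    Complex.sub_re, Complex.conj_ofReal, Complex.re_ofReal_mul] at h1
  rw [h2, h3] at h1
  nlinarith

/-- The Kalman condition outside the unit ball. -/
theorem CondB3.exists_lower_bound {n d : ℕ} {A : Fin n → ℝ → Matrix (Fin d) (Fin d) ℂ}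
    {B : ℝ → Matrix (Fin d) (Fin d) ℂ} (h : CondB3 A B) :
    ∃ c t₀ : ℝ, 0 < c ∧ 0 ≤ t₀ ∧ ∀ t, t₀ ≤ t → ∀ ξ : Rn n, 1 ≤ ‖ξ‖ → ∀ v : Cd d,
      c * ‖v‖ ^ 2 ≤ ∑ j : Fin d,
        ‖(Matrix.toEuclideanCLM (𝕜 := ℂ) (B t * symbolA A t ξ ^ (j : ℕ)) : Cd d →L[ℂ] Cd d) v‖ ^ 2 := by
  obtain ⟨c, hc, t₀, ht₀, hK⟩ := h (fun _ => 1) fun _ => one_pos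
  refine ⟨1 / c, t₀, by positivity, ht₀, fun t ht ξ hξ v => ?_⟩
  have hξ0 : 0 < ‖ξ‖ := by linarith
  have h1 := (hK t ht (‖ξ‖⁻¹ • ξ) (by rw [norm_smul, norm_inv, norm_norm,
    inv_mul_cancel₀ hξ0.ne']) v).1
  refine h1.trans (Finset.sum_le_sum fun j _ => ?_)
  -- By homogeneity the `j`-th summand grows by `|ξ|^(2j) ≥ 1` compared with the unit sphere.
  have h2 : symbolA A t ξ = (‖ξ‖ : ℂ) • symbolA A t (‖ξ‖⁻¹ • ξ) := by
    rw [← symbolA_smul, smul_smul, mul_inv_cancel₀ hξ0.ne', one_smul]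
  rw [h2, smul_pow, mul_smul_comm, map_smul, one_mul, smul_apply, norm_smul,
    mul_pow]
  refine le_mul_of_one_le_left (sq_nonneg _) (one_le_pow₀ ?_)
  rw [norm_pow, Complex.norm_real, norm_norm]
  exact one_le_pow₀ hξ

/-! ### Operators in `L²` -/

section

variable {α : Type*} [MeasurableSpace α] {μ : Measure α} {d : ℕ}

/-- The action of a matrix on the values of an `L²` function. -/
noncomputable def matOp (μ : Measure α) (d : ℕ) :
    (Cd d →L[ℂ] Cd d) →L[ℝ] (Lp (Cd d) 2 μ →L[ℝ] Lp (Cd d) 2 μ) :=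
  (ContinuousLinearMap.restrictScalarsL ℂ (Lp (Cd d) 2 μ) (Lp (Cd d) 2 μ) ℝ ℝ).comp
    (((ContinuousLinearMap.id ℂ (Cd d →L[ℂ] Cd d)).compLpL₂ 2 μ).restrictScalars ℝ)

theorem matOp_apply (K : Cd d →L[ℂ] Cd d) (f : Lp (Cd d) 2 μ) :
    matOp μ d K f = K.compLpL 2 μ f := rfl

theorem coeFn_matOp (K : Cd d →L[ℂ] Cd d) (f : Lp (Cd d) 2 μ) :
    matOp μ d K f =ᵐ[μ] fun x => K (f x) :=
  K.coeFn_compLpL f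

theorem norm_matOp_le (K : Cd d →L[ℂ] Cd d) : ‖matOp μ d K‖ ≤ ‖K‖ :=
  ContinuousLinearMap.opNorm_le_bound _ (norm_nonneg _) fun f => K.norm_compLp_le f

/-- Multiplication of an `L²` function by a bounded function. -/
noncomputable def mulOp (d : ℕ) (φ : Lp ℂ ∞ μ) : Lp (Cd d) 2 μ →L[ℝ] Lp (Cd d) 2 μ :=
  (((ContinuousLinearMap.lsmul ℂ ℂ : ℂ →L[ℂ] Cd d →L[ℂ] Cd d).holderL μ ∞ 2 2 φ)).restrictScalars ℝ

theorem coeFn_mulOp (φ : Lp ℂ ∞ μ) (f : Lp (Cd d) 2 μ) :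
    mulOp d φ f =ᵐ[μ] fun x => φ x • f x :=
  (ContinuousLinearMap.lsmul ℂ ℂ : ℂ →L[ℂ] Cd d →L[ℂ] Cd d).coeFn_holder φ f

theorem norm_mulOp_le (φ : Lp ℂ ∞ μ) : ‖mulOp d φ‖ ≤ ‖φ‖ := by
  refine ContinuousLinearMap.opNorm_le_bound _ (norm_nonneg _) fun f => ?_
  refine ((ContinuousLinearMap.lsmul ℂ ℂ : ℂ →L[ℂ] Cd d →L[ℂ] Cd d).norm_holder_apply_apply_le
    φ f).trans ?_
  gcongr
  exact mul_le_of_le_one_left (norm_nonneg _) ContinuousLinearMap.opNorm_lsmul_le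

theorem norm_sq_eq_integral (f : Lp (Cd d) 2 μ) : ‖f‖ ^ 2 = ∫ x, ‖f x‖ ^ 2 ∂μ := by
  rw [← inner_self_eq_norm_sq (𝕜 := ℂ) f, L2.inner_def, ← integral_re (L2.integrable_inner f f)]
  exact integral_congr_ae (Eventually.of_forall fun x => inner_self_eq_norm_sq (𝕜 := ℂ) (f x))

theorem integrable_norm_sq (f : Lp (Cd d) 2 μ) : Integrable (fun x => ‖f x‖ ^ 2) μ :=
  (Lp.memLp f).integrable_norm_pow two_ne_zero

end

/-- The annulus `σ < |ξ| < 2σ`. -/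
def annulus (n : ℕ) (σ : ℝ) : Set (Rn n) := {ξ | σ < ‖ξ‖ ∧ ‖ξ‖ < 2 * σ}

theorem isOpen_annulus (n : ℕ) (σ : ℝ) : IsOpen (annulus n σ) :=
  (isOpen_lt continuous_const continuous_norm).inter (isOpen_lt continuous_norm continuous_const)

/-- Lebesgue measure on the annulus. -/
noncomputable abbrev annulusMeasure (n : ℕ) (σ : ℝ) : Measure (Rn n) :=
  volume.restrict (annulus n σ)

theorem ae_mem_annulus (n : ℕ) (σ : ℝ) : ∀ᵐ ξ ∂annulusMeasure n σ, ξ ∈ annulus n σ :=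
  ae_restrict_mem (isOpen_annulus n σ).measurableSet

/-- Dividing by `σ` makes the multipliers bounded independently of the annulus; the size of the
frequency survives only in the factor `ρ = 2πσ` of the equation. -/
theorem ae_norm_coord_le {n : ℕ} {σ : ℝ} (hσ : 0 < σ) (k : Fin n) :
    ∀ᵐ ξ ∂annulusMeasure n σ, ‖((σ⁻¹ * ξ k : ℝ) : ℂ)‖ ≤ 2 := by
  filter_upwards [ae_mem_annulus n σ] with ξ hξ
  rw [Complex.norm_real, norm_mul, norm_inv, Real.norm_of_nonneg hσ.le, inv_mul_le_iff₀ hσ]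
  have := PiLp.norm_apply_le ξ k
  linarith [hξ.2]

theorem memLp_coord {n : ℕ} {σ : ℝ} (hσ : 0 < σ) (k : Fin n) :
    MemLp (fun ξ : Rn n => ((σ⁻¹ * ξ k : ℝ) : ℂ)) ∞ (annulusMeasure n σ) :=
  memLp_top_of_bound (by fun_prop : Continuous fun ξ : Rn n =>
    ((σ⁻¹ * ξ k : ℝ) : ℂ)).aestronglyMeasurable 2 (ae_norm_coord_le hσ k)

section

variable {n d : ℕ} {σ : ℝ} (hσ : 0 < σ) (A : Fin n → ℝ → Matrix (Fin d) (Fin d) ℂ)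
  (B : ℝ → Matrix (Fin d) (Fin d) ℂ)

/-- The coordinate `ξₖ / σ` as a bounded function on the annulus. -/
noncomputable def coordLp (k : Fin n) : Lp ℂ ∞ (annulusMeasure n σ) := (memLp_coord hσ k).toLp _

theorem norm_coordLp_le (k : Fin n) : ‖coordLp hσ k‖ ≤ 2 := by
  rw [coordLp, Lp.norm_toLp]
  refine ENNReal.toReal_le_of_le_ofReal (by norm_num) ?_
  rw [eLpNorm_exponent_top]
  exact eLpNormEssSup_le_of_ae_bound (ae_norm_coord_le hσ k)

/-- The operator of multiplication by a linear form in `ξ / σ` with matrix coefficients. -/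
noncomputable def annulusOp (K : Fin n → Cd d →L[ℂ] Cd d) :
    Lp (Cd d) 2 (annulusMeasure n σ) →L[ℝ] Lp (Cd d) 2 (annulusMeasure n σ) :=
  ∑ k, mulOp d (coordLp hσ k) * matOp _ d (K k)

theorem coeFn_annulusOp (K : Fin n → Cd d →L[ℂ] Cd d)
    (f : Lp (Cd d) 2 (annulusMeasure n σ)) :
    ∀ᵐ ξ ∂annulusMeasure n σ,
      annulusOp hσ K f ξ = ∑ k, ((σ⁻¹ * ξ k : ℝ) : ℂ) • K k (f ξ) := by
  have h1 : annulusOp hσ K f = ∑ k, mulOp d (coordLp hσ k) (matOp _ d (K k) f) := by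
    simp [annulusOp, sum_apply, mul_apply_eq_comp]
  have h2 : ∀ k, ∀ᵐ ξ ∂annulusMeasure n σ, mulOp d (coordLp hσ k) (matOp _ d (K k) f) ξ =
      ((σ⁻¹ * ξ k : ℝ) : ℂ) • K k (f ξ) := by
    intro k
    filter_upwards [coeFn_mulOp (coordLp hσ k) (matOp _ d (K k) f), coeFn_matOp (K k) f,
      (memLp_coord hσ k).coeFn_toLp] with ξ e1 e2 e3
    rw [e1, e2, coordLp, e3]
  rw [h1]
  filter_upwards [Lp.coeFn_finsetSum Finset.univ
    (fun k => mulOp d (coordLp hσ k) (matOp _ d (K k) f)), ae_all_iff.2 h2] with ξ e1 e2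
  rw [e1, Finset.sum_apply]
  exact Finset.sum_congr rfl fun k _ => e2 k

theorem norm_annulusOp_le (K : Fin n → Cd d →L[ℂ] Cd d) :
    ‖annulusOp hσ K‖ ≤ 2 * ∑ k, ‖K k‖ := by
  refine (norm_sum_le _ _).trans ?_
  rw [Finset.mul_sum]
  refine Finset.sum_le_sum fun k _ => (norm_mul_le _ _).trans ?_
  gcongr
  · exact (norm_mulOp_le _).trans (norm_coordLp_le hσ k)
  · exact norm_matOp_le _

/-- The operator of multiplication by `A(t, ξ / σ)`. -/
noncomputable def annulusA (t : ℝ) :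
    Lp (Cd d) 2 (annulusMeasure n σ) →L[ℝ] Lp (Cd d) 2 (annulusMeasure n σ) :=
  annulusOp hσ fun k => Matrix.toEuclideanCLM (𝕜 := ℂ) (A k t)

/-- The operator of multiplication by `B(t)`. -/
noncomputable def annulusB (n : ℕ) (σ : ℝ) (t : ℝ) :
    Lp (Cd d) 2 (annulusMeasure n σ) →L[ℝ] Lp (Cd d) 2 (annulusMeasure n σ) :=
  matOp _ d (Matrix.toEuclideanCLM (𝕜 := ℂ) (B t))

theorem coeFn_annulusA (t : ℝ) (f : Lp (Cd d) 2 (annulusMeasure n σ)) :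
    ∀ᵐ ξ ∂annulusMeasure n σ, annulusA hσ A t f ξ =
      (Matrix.toEuclideanCLM (𝕜 := ℂ) (symbolA A t (σ⁻¹ • ξ)) : Cd d →L[ℂ] Cd d) (f ξ) := by
  filter_upwards [coeFn_annulusOp hσ (fun k => Matrix.toEuclideanCLM (𝕜 := ℂ) (A k t)) f]
    with ξ h
  rw [annulusA, h, symbolA, map_sum, sum_apply]
  refine Finset.sum_congr rfl fun k _ => ?_
  rw [map_smul, smul_apply]
  rfl

theorem coeFn_annulusB (t : ℝ) (f : Lp (Cd d) 2 (annulusMeasure n σ)) :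
    ∀ᵐ ξ ∂annulusMeasure n σ, annulusB B n σ t f ξ =
      (Matrix.toEuclideanCLM (𝕜 := ℂ) (B t) : Cd d →L[ℂ] Cd d) (f ξ) :=
  coeFn_matOp _ f

theorem coeFn_annulusB_mul_pow (t : ℝ) (j : ℕ) (f : Lp (Cd d) 2 (annulusMeasure n σ)) :
    ∀ᵐ ξ ∂annulusMeasure n σ, (annulusB B n σ t * annulusA hσ A t ^ j) f ξ =
      (Matrix.toEuclideanCLM (𝕜 := ℂ) (B t * symbolA A t (σ⁻¹ • ξ) ^ j) : Cd d →L[ℂ] Cd d)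
        (f ξ) := by
  induction j generalizing f with
  | zero => simpa using coeFn_annulusB B t f
  | succ j ih =>
    filter_upwards [ih (annulusA hσ A t f), coeFn_annulusA hσ A t f] with ξ h1 h2
    rw [pow_succ, ← mul_assoc, mul_apply_eq_comp, h1, h2, pow_succ, ← mul_assoc,
      map_mul (Matrix.toEuclideanCLM (𝕜 := ℂ)) (B t * symbolA A t (σ⁻¹ • ξ) ^ j)]
    rfl

end

theorem matOp_I_smul {α : Type*} [MeasurableSpace α] {μ : Measure α} {d : ℕ}
    (K : Cd d →L[ℂ] Cd d) (f : Lp (Cd d) 2 μ) :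
    matOp μ d K (Complex.I • f) = Complex.I • matOp μ d K f := by
  simp only [matOp_apply]
  exact map_smul _ _ _

theorem mulOp_I_smul {α : Type*} [MeasurableSpace α] {μ : Measure α} {d : ℕ}
    (φ : Lp ℂ ∞ μ) (f : Lp (Cd d) 2 μ) :
    mulOp d φ (Complex.I • f) = Complex.I • mulOp d φ f :=
  map_smul ((ContinuousLinearMap.lsmul ℂ ℂ : ℂ →L[ℂ] Cd d →L[ℂ] Cd d).holderL μ ∞ 2 2 φ) _ _

section

variable {n d : ℕ} {σ : ℝ} (hσ : 0 < σ) {A : Fin n → ℝ → Matrix (Fin d) (Fin d) ℂ}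
  {B : ℝ → Matrix (Fin d) (Fin d) ℂ} {t : ℝ}

theorem hasDerivWithinAt_annulusA {A' : Fin n → Cd d →L[ℂ] Cd d} {s : Set ℝ}
    (hA : ∀ k, HasDerivWithinAt
      (fun s => (Matrix.toEuclideanCLM (𝕜 := ℂ) (A k s) : Cd d →L[ℂ] Cd d)) (A' k) s t) :
    HasDerivWithinAt (annulusA hσ A) (annulusOp hσ A') s t := by
  unfold annulusA annulusOp
  exact HasDerivWithinAt.fun_sum fun k _ =>
    (((matOp (annulusMeasure n σ) d).hasFDerivAt.comp_hasDerivWithinAt t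
      (hA k)).const_mul (mulOp d (coordLp hσ k)))

theorem annulusA_I_smul (f : Lp (Cd d) 2 (annulusMeasure n σ)) :
    annulusA hσ A t (Complex.I • f) = Complex.I • annulusA hσ A t f := by
  simp only [annulusA, annulusOp, sum_apply, mul_apply_eq_comp,
    matOp_I_smul, mulOp_I_smul, Finset.smul_sum]

theorem im_inner_annulusA (hA : ∀ k, (A k t).IsHermitian)
    (f : Lp (Cd d) 2 (annulusMeasure n σ)) : (inner ℂ f (annulusA hσ A t f)).im = 0 := by
  have h1 : (inner ℂ f (annulusA hσ A t f)).im =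
      ∫ ξ, (inner ℂ (f ξ) (annulusA hσ A t f ξ)).im ∂annulusMeasure n σ := by
    rw [L2.inner_def]
    exact (integral_im (𝕜 := ℂ) (L2.integrable_inner (𝕜 := ℂ) f _)).symm
  rw [h1]
  refine integral_eq_zero_of_ae ?_
  filter_upwards [coeFn_annulusA hσ A t f] with ξ h2
  rw [h2]
  exact im_inner_toEuclideanCLM (isHermitian_symbolA hA _) _

theorem norm_sq_annulusB_le (hB : (B t).PosSemidef) {M : ℝ} (hM0 : 0 < M)
    (hM : ‖(Matrix.toEuclideanCLM (𝕜 := ℂ) (B t) : Cd d →L[ℂ] Cd d)‖ ≤ M)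
    (f : Lp (Cd d) 2 (annulusMeasure n σ)) :
    ‖annulusB B n σ t f‖ ^ 2 ≤ M * (inner ℂ f (annulusB B n σ t f)).re := by
  have h1 : (inner ℂ f (annulusB B n σ t f)).re =
      ∫ ξ, (inner ℂ (f ξ) (annulusB B n σ t f ξ)).re ∂annulusMeasure n σ := by
    rw [L2.inner_def]
    exact (integral_re (𝕜 := ℂ) (L2.integrable_inner (𝕜 := ℂ) f _)).symm
  rw [h1, norm_sq_eq_integral, ← integral_const_mul]
  refine integral_mono_ae (integrable_norm_sq _)
    ((L2.integrable_inner (𝕜 := ℂ) f (annulusB B n σ t f)).re.const_mul M) ?_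
  filter_upwards [coeFn_annulusB B t f] with ξ h2
  rw [h2]
  exact norm_sq_toEuclideanCLM_le hB hM0 hM _

end

/-- The operators on the annulus form a dissipative family, uniformly in `σ`. -/
theorem exists_dissipativeFamily_annulus {n d : ℕ} {A : Fin n → ℝ → Matrix (Fin d) (Fin d) ℂ}
    {B : ℝ → Matrix (Fin d) (Fin d) ℂ} (hA : ∀ k, MatTClass 0 (A k)) (hB : MatTClass 0 B)
    (hB1 : CondB1 A B) :
    ∃ M : ℝ, 1 ≤ M ∧ ∀ {σ : ℝ} (hσ : 0 < σ), ∃ A' B',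
      DissipativeFamily M (annulusA hσ A) (annulusB B n σ) A' B' := by
  choose A' MA hMA hA' using fun k => (hA k).exists_hasDerivWithinAt
  obtain ⟨B', MB, hMB, hB'⟩ := hB.exists_hasDerivWithinAt
  have hS : 0 ≤ ∑ k, MA k := Finset.sum_nonneg fun k _ => hMA k
  obtain ⟨M, hM⟩ : ∃ M, M = 1 + MB + 2 * ∑ k, MA k := ⟨_, rfl⟩
  have hM1 : 1 ≤ M := by linarith
  refine ⟨M, hM1, fun {σ} hσ => ⟨fun t => annulusOp hσ fun k => A' k t,
    fun t => matOp _ d (B' t), ?_⟩⟩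
  constructor
  · exact fun t ht => hasDerivWithinAt_annulusA hσ fun k => (hA' k t ht).1
  · intro t ht
    exact (matOp (annulusMeasure n σ) d).hasFDerivAt.comp_hasDerivWithinAt t (hB' t ht).1
  · intro t ht
    refine (norm_annulusOp_le hσ _).trans ?_
    have := Finset.sum_le_sum fun k (_ : k ∈ Finset.univ) => (hA' k t ht).2.1
    linarith
  · intro t ht
    refine (norm_matOp_le _).trans ?_
    have := (hB' t ht).2.1
    linarith
  · intro t ht
    have ht1 : 0 < 1 + t := by linarith
    refine (norm_annulusOp_le hσ _).trans ?_
    have := Finset.sum_le_sum fun k (_ : k ∈ Finset.univ) => (hA' k t ht).2.2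
    rw [← Finset.sum_div] at this
    refine (mul_le_mul_of_nonneg_left this zero_le_two).trans ?_
    rw [← mul_div_assoc]
    gcongr
    linarith
  · intro t ht
    have ht1 : 0 < 1 + t := by linarith
    refine (norm_matOp_le _).trans ((hB' t ht).2.2.trans ?_)
    gcongr
    linarith
  · exact fun t _ => annulusA_I_smul hσ
  · exact fun t _ => matOp_I_smul _
  · exact fun t ht => im_inner_annulusA hσ (hB1 t ht).1
  · intro t ht f
    refine norm_sq_annulusB_le (hB1 t ht).2 (by linarith) ?_ f
    have := (hB' t ht).2.1
    linarith

/-- On the annulus `ξ / σ` lies outside the unit ball, so the pointwise Kalman bound can be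
integrated. -/
theorem kalman_annulus {n d : ℕ} {A : Fin n → ℝ → Matrix (Fin d) (Fin d) ℂ}
    {B : ℝ → Matrix (Fin d) (Fin d) ℂ} {c t : ℝ}
    (hK : ∀ ξ : Rn n, 1 ≤ ‖ξ‖ → ∀ v : Cd d, c * ‖v‖ ^ 2 ≤ ∑ j : Fin d,
        ‖(Matrix.toEuclideanCLM (𝕜 := ℂ) (B t * symbolA A t ξ ^ (j : ℕ)) : Cd d →L[ℂ] Cd d) v‖ ^ 2)
    {σ : ℝ} (hσ : 0 < σ) (f : Lp (Cd d) 2 (annulusMeasure n σ)) :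
    c * ‖f‖ ^ 2 ≤ ∑ j ∈ Finset.range d, ‖(annulusB B n σ t * annulusA hσ A t ^ j) f‖ ^ 2 := by
  simp_rw [norm_sq_eq_integral]
  rw [← integral_const_mul, ← integral_finsetSum _ fun j _ => integrable_norm_sq _]
  refine integral_mono_ae ((integrable_norm_sq _).const_mul c)
    (integrable_finsetSum _ fun j _ => integrable_norm_sq _) ?_
  filter_upwards [ae_mem_annulus n σ,
    ae_all_iff.2 fun j => coeFn_annulusB_mul_pow hσ A B t j f] with ξ h1 h2
  simp_rw [h2]
  rw [Finset.sum_range fun j => ‖(Matrix.toEuclideanCLM (𝕜 := ℂ)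
    (B t * symbolA A t (σ⁻¹ • ξ) ^ j) : Cd d →L[ℂ] Cd d) (f ξ)‖ ^ 2]
  refine hK _ ?_ _
  rw [norm_smul, norm_inv, Real.norm_of_nonneg hσ.le, ← div_eq_inv_mul, one_le_div hσ]
  exact h1.1.le

/-! ### The equation on the Fourier side -/

/-- Weakly differentiable curves with a continuous derivative are differentiable. -/
theorem hasDerivWithinAt_of_forall_clm {ι H F : Type*} [NormedAddCommGroup H] [NormedSpace ℝ H]
    [CompleteSpace H] [NormedAddCommGroup F] [NormedSpace ℝ F] (l : ι → H →L[ℝ] F)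
    (hl : ∀ x, (∀ i, l i x = 0) → x = 0) {X Z : ℝ → H}
    (hZ : ContinuousOn Z (Ici 0))
    (h : ∀ i t, 0 ≤ t → HasDerivWithinAt (fun s => l i (X s)) (l i (Z t)) (Ici 0) t) {t : ℝ}
    (ht : 0 ≤ t) : HasDerivWithinAt X (Z t) (Ici 0) t := by
  -- A continuous extension to negative times gives the primitive `Y` two-sided derivatives. Each `l
  -- i (X - Y)` then has zero derivative on `[0, ∞)` and starts at `0`, so `X = Y`.
  let Z' : ℝ → H := fun s => Z (max s 0)
  have hZ' : Continuous Z' := hZ.comp_continuous (by fun_prop) fun s => le_max_right s 0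
  have hZZ : ∀ s, 0 ≤ s → Z' s = Z s := fun s hs => by simp only [Z', max_eq_left hs]
  let Y : ℝ → H := fun s => X 0 + ∫ r in (0 : ℝ)..s, Z' r
  have hY : ∀ s, HasDerivAt Y (Z' s) s := fun s =>
    (hZ'.integral_hasStrictDerivAt 0 s).hasDerivAt.const_add _
  have hXY : ∀ s, 0 ≤ s → X s = Y s := by
    intro s hs
    rw [← sub_eq_zero]
    refine hl _ fun i => ?_
    have hd : ∀ r, 0 ≤ r → HasDerivWithinAt (fun r => l i (X r - Y r)) 0 (Ici 0) r := by
      intro r hr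
      have h1 := (h i r hr).sub
        ((l i).hasFDerivAt.comp_hasDerivWithinAt r (hY r).hasDerivWithinAt)
      rw [hZZ r hr, sub_self] at h1
      refine h1.congr_of_mem (fun u _ => ?_) hr
      simp
    have := constant_of_has_deriv_right_zero (f := fun r => l i (X r - Y r)) (a := 0) (b := s)
      (fun r hr => ((hd r hr.1).continuousWithinAt).mono Icc_subset_Ici_self)
      (fun r hr => (hd r hr.1).mono (Ici_subset_Ici.2 hr.1)) s (right_mem_Icc.2 hs)
    rw [this]
    simp [Y]
  have h2 := (hY t).hasDerivWithinAt (s := Ici 0)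
  rw [hZZ t ht] at h2
  exact h2.congr_of_mem (fun s hs => hXY s hs) ht

theorem exists_clm_eq_integral_smul {α : Type*} [MeasurableSpace α] {μ : Measure α} (d : ℕ)
    {ψ : α → ℂ} (hψ : MemLp ψ 2 μ) :
    ∃ l : Lp (Cd d) 2 μ →L[ℝ] Cd d, ∀ f, l f = ∫ x, ψ x • f x ∂μ := by
  refine ⟨((ContinuousLinearMap.lsmul ℂ ℂ : ℂ →L[ℂ] Cd d →L[ℂ] Cd d).lpPairing μ 2 2
    (hψ.toLp ψ)).restrictScalars ℝ, fun f => ?_⟩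
  refine (ContinuousLinearMap.lpPairing_eq_integral _ _ _).trans (integral_congr_ae ?_)
  filter_upwards [hψ.coeFn_toLp] with x hx
  simp [hx]

theorem integrable_schwartz_smul {n d : ℕ} (ψ : 𝓢(Rn n, ℂ))
    (f : Lp (Cd d) 2 (volume : Measure (Rn n))) : Integrable (fun ξ => ψ ξ • f ξ) :=
  memLp_one_iff_integrable.1 ((Lp.memLp f).smul (ψ.memLp 2 volume))

/-- The equation is tested with `𝓕 ψ`, so that `∂ₖ` becomes `2πi ξₖ`. The product `A(t,ξ) 𝓕U` need
not be in `L²`, but the factor `ξₖ` can be put on the Schwartz function `ψ`. -/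
theorem IsSolution.hasDerivWithinAt_integral {n d : ℕ}
    {A : Fin n → ℝ → Matrix (Fin d) (Fin d) ℂ} {B : ℝ → Matrix (Fin d) (Fin d) ℂ}
    {U₀ : 𝓢'(Rn n, Cd d)} {U : ℝ → Lp (Cd d) 2 (volume : Measure (Rn n))}
    (hU : IsSolution A B U₀ U) (ψ : 𝓢(Rn n, ℂ)) {t : ℝ} (ht : 0 ≤ t) :
    HasDerivWithinAt
      (fun s => ∫ ξ, ψ ξ • (𝓕 (U s) : Lp (Cd d) 2 (volume : Measure (Rn n))) ξ)
      (∫ ξ, ψ ξ • ((2 * Real.pi * Complex.I) •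
          (Matrix.toEuclideanCLM (𝕜 := ℂ) (symbolA A t ξ) : Cd d →L[ℂ] Cd d)
            ((𝓕 (U t) : Lp (Cd d) 2 (volume : Measure (Rn n))) ξ) -
          (Matrix.toEuclideanCLM (𝕜 := ℂ) (B t) : Cd d →L[ℂ] Cd d)
            ((𝓕 (U t) : Lp (Cd d) 2 (volume : Measure (Rn n))) ξ)))
      (Ici 0) t := by
  set F : Lp (Cd d) 2 (volume : Measure (Rn n)) := 𝓕 (U t) with hF
  have h0 : ∀ s (χ : 𝓢(Rn n, ℂ)), (U s : 𝓢'(Rn n, Cd d)) (𝓕 χ) =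
      ∫ ξ, χ ξ • (𝓕 (U s) : Lp (Cd d) 2 (volume : Measure (Rn n))) ξ := by
    intro s χ
    rw [← Lp.toTemperedDistribution_apply, ← Lp.fourier_toTemperedDistribution_eq]
    rfl
  let e : Fin n → Rn n := fun k => EuclideanSpace.single k (1 : ℝ)
  let φ : Fin n → 𝓢(Rn n, ℂ) := fun k =>
    SchwartzMap.smulLeftCLM ℂ (fun ξ => ((inner ℝ ξ (e k) : ℝ) : ℂ)) ψ
  have hφ : ∀ k ξ, φ k ξ = (ξ k : ℂ) * ψ ξ := by
    intro k ξ
    have hg : (fun ξ : Rn n => ((inner ℝ ξ (e k) : ℝ) : ℂ)).HasTemperateGrowth := by fun_prop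
    simp only [φ]
    rw [SchwartzMap.smulLeftCLM_apply_apply hg]
    simp [e, EuclideanSpace.inner_single_right]
  have h1 : ∀ k, (∂_{e k} (U t : 𝓢'(Rn n, Cd d)) : 𝓢'(Rn n, Cd d)) (𝓕 ψ) =
      (2 * Real.pi * Complex.I) • ∫ ξ, φ k ξ • F ξ := by
    intro k
    have h2 := congrArg (fun u : 𝓢'(Rn n, Cd d) => u ψ)
      (TemperedDistribution.fourier_lineDerivOp_eq (U t : 𝓢'(Rn n, Cd d)) (e k))
    refine h2.trans ?_
    rw [← h0]
    rfl
  have h3 := hU.equation (𝓕 ψ) t ht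
  simp_rw [h0] at h3
  convert h3 using 1
  have h4 : ∀ k, Matrix.toEuclideanLin (A k t)
      ((-Complex.I) • (∂_{e k} (U t : 𝓢'(Rn n, Cd d)) : 𝓢'(Rn n, Cd d)) (𝓕 ψ)) =
      (2 * Real.pi : ℂ) • ∫ ξ, (Matrix.toEuclideanCLM (𝕜 := ℂ) (A k t) : Cd d →L[ℂ] Cd d)
        (φ k ξ • F ξ) := by
    intro k
    rw [h1, ContinuousLinearMap.integral_comp_comm _ (integrable_schwartz_smul _ _), smul_smul,
      map_smul]
    congr 1
    linear_combination (-2 * Real.pi : ℂ) * Complex.I_mul_I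
  have h5 : Matrix.toEuclideanLin (B t) (∫ ξ, ψ ξ • F ξ) =
      ∫ ξ, (Matrix.toEuclideanCLM (𝕜 := ℂ) (B t) : Cd d →L[ℂ] Cd d) (ψ ξ • F ξ) :=
    (ContinuousLinearMap.integral_comp_comm
      (Matrix.toEuclideanCLM (𝕜 := ℂ) (B t) : Cd d →L[ℂ] Cd d)
      (integrable_schwartz_smul ψ F)).symm
  have hi : ∀ k, Integrable (fun ξ =>
      (Matrix.toEuclideanCLM (𝕜 := ℂ) (A k t) : Cd d →L[ℂ] Cd d) (φ k ξ • F ξ)) := fun k =>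
    ContinuousLinearMap.integrable_comp _ (integrable_schwartz_smul _ _)
  have hiB : Integrable (fun ξ =>
      (Matrix.toEuclideanCLM (𝕜 := ℂ) (B t) : Cd d →L[ℂ] Cd d) (ψ ξ • F ξ)) :=
    ContinuousLinearMap.integrable_comp _ (integrable_schwartz_smul _ _)
  have hiA : Integrable (fun ξ => (Complex.I * (2 * Real.pi)) •
      ∑ k, (Matrix.toEuclideanCLM (𝕜 := ℂ) (A k t) : Cd d →L[ℂ] Cd d) (φ k ξ • F ξ)) :=
    (integrable_finsetSum _ fun k _ => hi k).smul (Complex.I * (2 * Real.pi))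
  rw [h5, Finset.sum_congr rfl fun k _ => h4 k, ← Finset.smul_sum,
    ← integral_finsetSum _ fun k _ => hi k, smul_add, smul_smul, smul_smul, Complex.I_mul_I,
    neg_one_smul, ← sub_eq_add_neg, ← integral_smul,
    ← integral_sub hiA hiB]
  refine integral_congr_ae (Eventually.of_forall fun ξ => ?_)
  simp only [smul_sub, map_smul, hφ]
  congr 1
  simp only [symbolA, map_sum, map_smul, sum_apply, smul_apply, Finset.smul_sum, smul_smul]
  refine Finset.sum_congr rfl fun k _ => ?_
  congr 1
  ring

section

variable {n d : ℕ} {σ : ℝ}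

theorem coeFn_smul_real (c : ℝ) (f : Lp (Cd d) 2 (annulusMeasure n σ)) :
    ⇑(c • f) =ᵐ[annulusMeasure n σ] c • ⇑f := Lp.coeFn_smul c f

/-- The restriction of the Fourier transform to an annulus solves the system. -/
theorem IsSolution.hasDerivWithinAt_annulus (hσ : 0 < σ)
    {A : Fin n → ℝ → Matrix (Fin d) (Fin d) ℂ} {B : ℝ → Matrix (Fin d) (Fin d) ℂ}
    {U₀ : 𝓢'(Rn n, Cd d)} {U : ℝ → Lp (Cd d) 2 (volume : Measure (Rn n))}
    (hU : IsSolution A B U₀ U) (hAc : ContinuousOn (annulusA hσ A) (Ici 0))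
    (hBc : ContinuousOn (annulusB B n σ) (Ici 0))
    {X : ℝ → Lp (Cd d) 2 (annulusMeasure n σ)}
    (hX : X = fun t => LpToLpRestrictCLM (Rn n) (Cd d) ℂ volume 2 (annulus n σ) (𝓕 (U t)))
    {t : ℝ} (ht : 0 ≤ t) :
    HasDerivWithinAt X
      ((2 * Real.pi * σ) • Complex.I • annulusA hσ A t (X t) - annulusB B n σ t (X t))
      (Ici 0) t := by
  have hXc : ContinuousOn X (Ici 0) := by
    rw [hX]
    exact ((LpToLpRestrictCLM (Rn n) (Cd d) ℂ volume 2 (annulus n σ)).continuous.comp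
      (Lp.fourierTransformₗᵢ (Rn n) (Cd d)).continuous).comp_continuousOn hU.continuousOn
  -- These test functions separate `L²` of the annulus. The right-hand side is there a continuous
  -- `L²` curve, so the weak derivative is a strong one.
  let ι := {g : Rn n → ℝ // ContDiff ℝ ∞ g ∧ HasCompactSupport g ∧ tsupport g ⊆ annulus n σ}
  have hψ0 : ∀ g : ι, HasCompactSupport fun ξ => (g.1 ξ : ℂ) := fun g =>
    g.2.2.1.comp_left (g := fun x : ℝ => (x : ℂ)) Complex.ofReal_zero
  let ψ : ι → 𝓢(Rn n, ℂ) := fun g =>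
    (hψ0 g).toSchwartzMap (Complex.ofRealCLM.contDiff.comp g.2.1)
  have hψ : ∀ g ξ, ψ g ξ = (g.1 ξ : ℂ) := fun g ξ => rfl
  choose l hl using fun g : ι =>
    exists_clm_eq_integral_smul d (((ψ g).memLp 2 volume).restrict (annulus n σ))
  have hres : ∀ (g : ι) (G : Rn n → Cd d),
      ∫ ξ, ψ g ξ • G ξ ∂annulusMeasure n σ = ∫ ξ, ψ g ξ • G ξ := by
    intro g G
    refine setIntegral_eq_integral_of_forall_compl_eq_zero fun ξ hξ => ?_
    rw [hψ, image_eq_zero_of_notMem_tsupport fun h => hξ (g.2.2.2 h)]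
    simp
  have hXF : ∀ s, X s =ᵐ[annulusMeasure n σ]
      (𝓕 (U s) : Lp (Cd d) 2 (volume : Measure (Rn n))) := by
    intro s
    rw [hX]
    exact LpToLpRestrictCLM_coeFn ℂ _ _
  refine hasDerivWithinAt_of_forall_clm
    (Z := fun t => (2 * Real.pi * σ) • Complex.I • annulusA hσ A t (X t) - annulusB B n σ t (X t))
    l ?_ ?_ ?_ ht
  · intro f hf
    have h1 : ∀ᵐ ξ ∂annulusMeasure n σ, ξ ∈ annulus n σ → f ξ = 0 := by
      refine (isOpen_annulus n σ).ae_eq_zero_of_integral_contDiff_smul_eq_zero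
        (((Lp.memLp f).locallyIntegrable (by norm_num)).locallyIntegrableOn _)
        fun g g1 g2 g3 => ?_
      have := hf ⟨g, g1, g2, g3⟩
      rw [hl] at this
      rw [← this]
      refine integral_congr_ae (Eventually.of_forall fun ξ => ?_)
      simp only [hψ]
      rw [Complex.coe_smul]
    rw [Lp.eq_zero_iff_ae_eq_zero]
    filter_upwards [h1, ae_mem_annulus n σ] with ξ h2 h3 using h2 h3
  · exact (((hAc.clm_apply hXc).const_smul Complex.I).const_smul (2 * Real.pi * σ)).sub
      (hBc.clm_apply hXc)
  · intro g s hs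
    have h1 := hU.hasDerivWithinAt_integral (ψ g) hs
    simp_rw [hl]
    have h2 : ∀ r, ∫ ξ, ψ g ξ • X r ξ ∂annulusMeasure n σ =
        ∫ ξ, ψ g ξ • (𝓕 (U r) : Lp (Cd d) 2 (volume : Measure (Rn n))) ξ := by
      intro r
      rw [← hres]
      refine integral_congr_ae ?_
      filter_upwards [hXF r] with ξ h
      rw [h]
    simp_rw [h2]
    refine h1.congr_deriv ?_
    rw [← hres]
    symm
    refine integral_congr_ae ?_
    filter_upwards [hXF s, coeFn_annulusA hσ A s (X s), coeFn_annulusB B s (X s),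
      Lp.coeFn_sub ((2 * Real.pi * σ) • Complex.I • annulusA hσ A s (X s))
        (annulusB B n σ s (X s)),
      coeFn_smul_real (2 * Real.pi * σ) (Complex.I • annulusA hσ A s (X s)),
      Lp.coeFn_smul Complex.I (annulusA hσ A s (X s))] with ξ e1 e2 e3 e4 e5 e6
    rw [e4, Pi.sub_apply, e5, Pi.smul_apply, e6, Pi.smul_apply, e2, e3, e1, symbolA_smul,
      map_smul, smul_apply, ← Complex.coe_smul, smul_smul, smul_smul]
    congr 3
    push_cast
    field_simp

end

/-! ### Pointwise decay of the Fourier transform -/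

section

variable {n d : ℕ} {σ : ℝ}

theorem mulOp_annulusA (hσ : 0 < σ) (A : Fin n → ℝ → Matrix (Fin d) (Fin d) ℂ) (t : ℝ)
    (φ : Lp ℂ ∞ (annulusMeasure n σ)) (f : Lp (Cd d) 2 (annulusMeasure n σ)) :
    mulOp d φ (annulusA hσ A t f) = annulusA hσ A t (mulOp d φ f) := by
  apply Lp.ext
  filter_upwards [coeFn_mulOp φ (annulusA hσ A t f), coeFn_mulOp φ f, coeFn_annulusA hσ A t f,
    coeFn_annulusA hσ A t (mulOp d φ f)] with ξ h1 h2 h3 h4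
  rw [h1, h3, h4, h2, map_smul]

theorem mulOp_annulusB (B : ℝ → Matrix (Fin d) (Fin d) ℂ) (t : ℝ)
    (φ : Lp ℂ ∞ (annulusMeasure n σ)) (f : Lp (Cd d) 2 (annulusMeasure n σ)) :
    mulOp d φ (annulusB B n σ t f) = annulusB B n σ t (mulOp d φ f) := by
  apply Lp.ext
  filter_upwards [coeFn_mulOp φ (annulusB B n σ t f), coeFn_mulOp φ f, coeFn_annulusB B t f,
    coeFn_annulusB B t (mulOp d φ f)] with ξ h1 h2 h3 h4
  rw [h1, h3, h4, h2, map_smul]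

/-- Solutions of the system may be localized in `ξ`. -/
theorem hasDerivWithinAt_mulOp (hσ : 0 < σ) {A : Fin n → ℝ → Matrix (Fin d) (Fin d) ℂ}
    {B : ℝ → Matrix (Fin d) (Fin d) ℂ} {ρ t : ℝ} {s : Set ℝ}
    (φ : Lp ℂ ∞ (annulusMeasure n σ)) {X : ℝ → Lp (Cd d) 2 (annulusMeasure n σ)}
    (hX : HasDerivWithinAt X
      (ρ • Complex.I • annulusA hσ A t (X t) - annulusB B n σ t (X t)) s t) :
    HasDerivWithinAt (fun s => mulOp d φ (X s))
      (ρ • Complex.I • annulusA hσ A t (mulOp d φ (X t)) - annulusB B n σ t (mulOp d φ (X t)))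
      s t := by
  have h := (mulOp d φ).hasFDerivAt.comp_hasDerivWithinAt t hX
  rwa [map_sub, map_smul, mulOp_I_smul, mulOp_annulusA, mulOp_annulusB] at h

end

/-- Multiplication by the indicator of `s`: it turns norm estimates of localized solutions into
estimates of integrals over `s`. -/
theorem exists_mulOp_norm_sq_eq {α : Type*} [MeasurableSpace α] {μ : Measure α} (d : ℕ)
    {s : Set α} (hs : MeasurableSet s) :
    ∃ φ : Lp ℂ ∞ μ, ∀ f : Lp (Cd d) 2 μ, ‖mulOp d φ f‖ ^ 2 = ∫ x in s, ‖f x‖ ^ 2 ∂μ := by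
  have h : MemLp (s.indicator fun _ => (1 : ℂ)) ∞ μ :=
    (memLp_top_const (1 : ℂ)).indicator hs
  refine ⟨h.toLp _, fun f => ?_⟩
  rw [norm_sq_eq_integral, ← integral_indicator hs]
  refine integral_congr_ae ?_
  filter_upwards [coeFn_mulOp (h.toLp _) f, h.coeFn_toLp] with x h1 h2
  rw [h1, h2]
  by_cases hx : x ∈ s <;> simp [hx]

theorem decay_rate_mono {x y : ℝ} (hx : 0 ≤ x) (hxy : x ≤ y) :
    x ^ 2 / (1 + x ^ 2) ≤ y ^ 2 / (1 + y ^ 2) := by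
  rw [div_le_div_iff₀ (by positivity) (by positivity)]
  nlinarith [pow_le_pow_left₀ hx hxy 2]

/-- Countably many annuli cover `ξ ≠ 0`, so the exceptional null sets of the individual annuli can
be united. -/
theorem ae_exists_rat_mem_annulus {n : ℕ} (hn : 0 < n) :
    ∀ᵐ ξ : Rn n, ∃ a : {a : ℚ // 0 < a}, ξ ∈ annulus n (a : ℚ) := by
  have : Nonempty (Fin n) := ⟨⟨0, hn⟩⟩
  have h0 : ∀ᵐ ξ : Rn n, ξ ≠ 0 := by
    simp [ae_iff]
  filter_upwards [h0] with ξ hξ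
  have hξ' : 0 < ‖ξ‖ := norm_pos_iff.2 hξ
  obtain ⟨a, ha1, ha2⟩ := exists_rat_btwn (show ‖ξ‖ / 2 < ‖ξ‖ by linarith)
  have ha : 0 < a := by
    have : (0 : ℝ) < a := by linarith
    exact_mod_cast this
  exact ⟨⟨a, ha⟩, ha2, by linarith⟩

/-- The Fourier transforms of solutions decay exponentially in `t`, with the rate
`|ξ|² / (1 + |ξ|²)`. -/
theorem exists_ae_norm_sq_fourier_le {n d : ℕ} (hn : 0 < n) [NeZero d]
    {A : Fin n → ℝ → Matrix (Fin d) (Fin d) ℂ} {B : ℝ → Matrix (Fin d) (Fin d) ℂ}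
    (hA : ∀ k, MatTClass 0 (A k)) (hB : MatTClass 0 B) (hB1 : CondB1 A B) (hB3 : CondB3 A B) :
    ∃ C γ : ℝ, 0 < C ∧ 0 < γ ∧ ∀ (U₀ : 𝓢'(Rn n, Cd d))
      (U : ℝ → Lp (Cd d) 2 (volume : Measure (Rn n))), IsSolution A B U₀ U → ∀ t, 0 ≤ t →
        ∀ᵐ ξ : Rn n, ‖(𝓕 (U t) : Lp (Cd d) 2 (volume : Measure (Rn n))) ξ‖ ^ 2 ≤
          C * Real.exp (-γ * (‖ξ‖ ^ 2 / (1 + ‖ξ‖ ^ 2)) * t) *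
            ‖(𝓕 (U 0) : Lp (Cd d) 2 (volume : Measure (Rn n))) ξ‖ ^ 2 := by
  obtain ⟨M, hM, hfam⟩ := exists_dissipativeFamily_annulus hA hB hB1
  obtain ⟨c, t₀, hc, ht₀, hK⟩ := hB3.exists_lower_bound
  obtain ⟨m, hm⟩ : ∃ m, d = m + 1 := ⟨d - 1, (Nat.succ_pred_eq_of_ne_zero (NeZero.ne d)).symm⟩
  obtain ⟨C, γ, hC, hγ, hdec⟩ := DissipativeFamily.exists_decay m hM hc ht₀
  refine ⟨C, γ, hC, hγ, fun U₀ U hU t ht => ?_⟩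
  have key : ∀ a : {a : ℚ // 0 < a}, ∀ᵐ ξ : Rn n, ξ ∈ annulus n (a : ℚ) →
      ‖(𝓕 (U t) : Lp (Cd d) 2 (volume : Measure (Rn n))) ξ‖ ^ 2 ≤
        C * Real.exp (-γ * (‖ξ‖ ^ 2 / (1 + ‖ξ‖ ^ 2)) * t) *
          ‖(𝓕 (U 0) : Lp (Cd d) 2 (volume : Measure (Rn n))) ξ‖ ^ 2 := by
    rintro ⟨a, ha⟩
    have hσ : (0 : ℝ) < a := by exact_mod_cast ha
    obtain ⟨σ, hσa⟩ : ∃ σ : ℝ, σ = a := ⟨_, rfl⟩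
    simp only [← hσa]
    rw [← hσa] at hσ
    obtain ⟨A', B', hAB⟩ := hfam hσ
    obtain ⟨X, hX⟩ : ∃ X : ℝ → Lp (Cd d) 2 (annulusMeasure n σ), X = fun t =>
      LpToLpRestrictCLM (Rn n) (Cd d) ℂ volume 2 (annulus n σ) (𝓕 (U t)) := ⟨_, rfl⟩
    have hXF : ∀ s, X s =ᵐ[annulusMeasure n σ]
        (𝓕 (U s) : Lp (Cd d) 2 (volume : Measure (Rn n))) := by
      intro s
      rw [hX]
      exact LpToLpRestrictCLM_coeFn ℂ _ _
    have hXd := fun s (hs : 0 ≤ s) => hU.hasDerivWithinAt_annulus hσ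
      (fun s hs => (hAB.hasDeriv_A s hs).continuousWithinAt)
      (fun s hs => (hAB.hasDeriv_B s hs).continuousWithinAt) hX hs
    set ρ : ℝ := 2 * Real.pi * σ with hρ
    have hρ0 : 0 < ρ := by positivity
    -- The cut-off `mulOp d φ X` solves the same system, so the Hilbert space estimate holds over
    -- every measurable `s` with the same constants; this yields the pointwise bound `h2`.
    have h1 : ∀ s, MeasurableSet s →
        ∫ ξ in s, ‖X t ξ‖ ^ 2 ∂annulusMeasure n σ ≤
          ∫ ξ in s, C * Real.exp (-γ * (ρ ^ 2 / (1 + ρ ^ 2)) * t) * ‖X 0 ξ‖ ^ 2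
            ∂annulusMeasure n σ := by
      intro s hs
      obtain ⟨φ, hφ⟩ := exists_mulOp_norm_sq_eq (μ := annulusMeasure n σ) d hs
      rw [integral_const_mul, ← hφ, ← hφ]
      exact hdec _ _ _ _ hAB (fun t ht f => hm ▸ kalman_annulus (hK t ht) hσ f) ρ
        (fun s => mulOp d φ (X s)) hρ0
        (fun s hs => hasDerivWithinAt_mulOp hσ φ (hXd s hs)) t ht
    have h2 : ∀ᵐ ξ ∂annulusMeasure n σ, ‖X t ξ‖ ^ 2 ≤
        C * Real.exp (-γ * (ρ ^ 2 / (1 + ρ ^ 2)) * t) * ‖X 0 ξ‖ ^ 2 :=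
      ae_le_of_forall_setIntegral_le (integrable_norm_sq _) ((integrable_norm_sq _).const_mul _)
        fun s hs _ => h1 s hs
    have h3 : ∀ᵐ ξ ∂annulusMeasure n σ,
        ‖(𝓕 (U t) : Lp (Cd d) 2 (volume : Measure (Rn n))) ξ‖ ^ 2 ≤
        C * Real.exp (-γ * (‖ξ‖ ^ 2 / (1 + ‖ξ‖ ^ 2)) * t) *
          ‖(𝓕 (U 0) : Lp (Cd d) 2 (volume : Measure (Rn n))) ξ‖ ^ 2 := by
      filter_upwards [h2, hXF t, hXF 0, ae_mem_annulus n σ] with ξ e1 e2 e3 e4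
      rw [← e2, ← e3]
      refine e1.trans ?_
      have h5 : ‖ξ‖ ≤ ρ := by
        have := e4.2
        have := Real.pi_gt_three
        nlinarith
      have h6 := decay_rate_mono (norm_nonneg ξ) h5
      gcongr ?_ * Real.exp (?_ * t) * _
      nlinarith
    exact (ae_restrict_iff' (isOpen_annulus n σ).measurableSet).1 h3
  filter_upwards [ae_all_iff.2 key, ae_exists_rat_mem_annulus hn] with ξ h1 h2
  obtain ⟨a, ha⟩ := h2
  exact h1 a ha

/-! ### The `L^p`-`L^q` estimate -/

theorem exists_one_add_rpow_mul_exp_le {s γ : ℝ} (hs : 0 ≤ s) (hγ : 0 < γ) :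
    ∃ K : ℝ, 0 < K ∧ ∀ x, 0 ≤ x → (1 + x) ^ s * Real.exp (-γ * x) ≤ K := by
  -- Then `(1+x)^s` grows at most like `exp(sδx)` with `sδ ≤ γ`; the `+ 1` includes `s = 0`.
  obtain ⟨δ, hδ⟩ : ∃ δ, δ = γ / (s + 1) := ⟨_, rfl⟩
  have hδ0 : 0 < δ := by rw [hδ]; positivity
  have hsδ : s * δ ≤ γ := by
    rw [hδ, mul_div_assoc', div_le_iff₀ (by positivity)]
    nlinarith
  refine ⟨(1 + 1 / δ) ^ s, by positivity, fun x hx => ?_⟩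
  have h1 : 1 + x ≤ (1 + 1 / δ) * Real.exp (δ * x) := by
    have h2 := Real.add_one_le_exp (δ * x)
    have h3 : 0 ≤ δ * x := by positivity
    calc 1 + x = 1 + 1 / δ * (δ * x) := by field_simp
      _ ≤ Real.exp (δ * x) + 1 / δ * Real.exp (δ * x) := by gcongr <;> linarith
      _ = _ := by ring
  calc (1 + x) ^ s * Real.exp (-γ * x)
      ≤ ((1 + 1 / δ) * Real.exp (δ * x)) ^ s * Real.exp (-γ * x) := by gcongr
    _ = (1 + 1 / δ) ^ s * Real.exp (s * δ * x + -γ * x) := by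
        rw [Real.mul_rpow (by positivity) (by positivity), ← Real.exp_mul, Real.exp_add]
        ring_nf
    _ ≤ (1 + 1 / δ) ^ s * 1 := by
        gcongr
        rw [Real.exp_le_one_iff]
        nlinarith
    _ = _ := mul_one _

/-- The decay of the Fourier transform compensates the weights. -/
theorem exists_scaledWeight_mul_exp_le (n : ℕ) {r γ : ℝ} (hr : 0 ≤ r) (hγ : 0 < γ) :
    ∃ K : ℝ, 0 < K ∧ ∀ (r₁ r₂ : ℝ), r₁ + r₂ = r → ∀ (ξ : Rn n) (t : ℝ), 0 ≤ t →
      scaledWeight (1 + t) (r₁ / 2) ξ * Real.exp (-γ * (‖ξ‖ ^ 2 / (1 + ‖ξ‖ ^ 2)) * t) ≤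
        K * (scaledWeight (1 + t) (-(r₂ / 2)) ξ *
          (1 + (2 * Real.pi * ‖ξ‖) ^ 2) ^ (r / 2)) := by
  obtain ⟨K, hK, hKx⟩ := exists_one_add_rpow_mul_exp_le (s := r / 2) (by linarith) hγ
  refine ⟨K, hK, fun r₁ r₂ hrr ξ t ht => ?_⟩
  obtain ⟨a, ha⟩ : ∃ a, a = ‖ξ‖ ^ 2 := ⟨_, rfl⟩
  have ha0 : 0 ≤ a := by rw [ha]; positivity
  have h1 : 1 + a ≤ 1 + (2 * Real.pi * ‖ξ‖) ^ 2 := by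
    rw [mul_pow, ← ha]
    have := Real.pi_gt_three
    nlinarith [mul_nonneg ha0 (show 0 ≤ (2 * Real.pi) ^ 2 - 1 by nlinarith)]
  simp only [scaledWeight]
  rw [← ha]
  have hb : 0 < 1 + (1 + t) * a := by positivity
  have h2 : (1 + (1 + t) * a) ^ (r₁ / 2) =
      (1 + (1 + t) * a) ^ (-(r₂ / 2)) * (1 + (1 + t) * a) ^ (r / 2) := by
    rw [← Real.rpow_add hb]
    congr 1
    linarith
  -- The key identity: the second factor is a function of the very exponent `t a / (1 + a)` of the
  -- decay, and `1 + a` is dominated by the Bessel symbol.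
  have h3 : 1 + (1 + t) * a = (1 + a) * (1 + a / (1 + a) * t) := by
    field_simp
    ring
  have h4 : (1 + (1 + t) * a) ^ (r / 2) =
      (1 + a) ^ (r / 2) * (1 + a / (1 + a) * t) ^ (r / 2) := by
    rw [h3, Real.mul_rpow (by positivity) (by positivity)]
  rw [h2, mul_left_comm K, mul_assoc]
  gcongr ?_ * ?_
  rw [h4, mul_assoc, mul_comm K]
  have h5 := hKx (a / (1 + a) * t) (by positivity)
  rw [← mul_assoc (-γ)] at h5
  gcongr

/-- Products with functions of temperate growth are computed pointwise. -/
theorem ae_eq_of_eq_smulLeftCLM {n d : ℕ} {a : Rn n → ℂ} (ha : a.HasTemperateGrowth)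
    {f h : Lp (Cd d) 2 (volume : Measure (Rn n))}
    (hf : smulLeftCLM (Cd d) a (h : 𝓢'(Rn n, Cd d)) = f) : ∀ᵐ ξ : Rn n, f ξ = a ξ • h ξ := by
  have hloc : ∀ u : Lp (Cd d) 2 (volume : Measure (Rn n)), LocallyIntegrable u volume :=
    fun u => (Lp.memLp u).locallyIntegrable (by norm_num)
  refine ae_eq_of_integral_contDiff_smul_eq (hloc f)
    ((hloc h).continuous_smul ha.1.continuous) fun g g1 g2 => ?_
  have hg : HasCompactSupport fun ξ => (g ξ : ℂ) :=
    g2.comp_left (g := fun x : ℝ => (x : ℂ)) Complex.ofReal_zero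
  have h1 := congrArg (fun u : 𝓢'(Rn n, Cd d) =>
    u (hg.toSchwartzMap (Complex.ofRealCLM.contDiff.comp g1))) hf
  simp only [smulLeftCLM_apply_apply, Lp.toTemperedDistribution_apply] at h1
  have h2 : ∀ ξ, hg.toSchwartzMap (Complex.ofRealCLM.contDiff.comp g1) ξ = (g ξ : ℂ) :=
    fun _ => rfl
  simp only [SchwartzMap.smulLeftCLM_apply_apply ha, h2] at h1
  simp_rw [← Complex.coe_smul (g _)]
  rw [← h1]
  refine integral_congr_ae (Eventually.of_forall fun ξ => ?_)
  simp only [smul_eq_mul, mul_smul]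
  rw [smul_comm]

/-- The chain is `L^p → weighted L² → L^q`, with the pointwise decay passing from the weight `-r₂`
at time `0` to the weight `r₁` at time `t`. -/
theorem exists_eLpNorm_le_lprNorm {n d : ℕ} (hn : 0 < n) [NeZero d]
    {A : Fin n → ℝ → Matrix (Fin d) (Fin d) ℂ} {B : ℝ → Matrix (Fin d) (Fin d) ℂ}
    (hA : ∀ k, MatTClass 0 (A k)) (hB : MatTClass 0 B) (hB1 : CondB1 A B) (hB3 : CondB3 A B)
    {p q : ℝ≥0∞} [hp1 : Fact (1 ≤ p)] (hp : p ≤ 2) (hq : 2 ≤ q) {r : ℝ}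
    (hr : (n : ℝ) * ((p⁻¹).toReal - (q⁻¹).toReal) ≤ r)
    (hr' : p = 1 ∨ q = ⊤ → (n : ℝ) * ((p⁻¹).toReal - (q⁻¹).toReal) < r) :
    ∃ C : ℝ, 0 < C ∧ ∀ (U₀ : 𝓢'(Rn n, Cd d)) (U : ℝ → Lp (Cd d) 2 (volume : Measure (Rn n))),
      MemLpr p r U₀ → IsSolution A B U₀ U → ∀ t : ℝ, 0 ≤ t →
        eLpNorm (U t) q volume ≤
          ENNReal.ofReal (C * (1 + t) ^ (-((n : ℝ) / 2 * ((p⁻¹).toReal - (q⁻¹).toReal)))) *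
            lprNorm p r U₀ := by
  obtain ⟨e, he⟩ : ∃ e, e = r - (n : ℝ) * ((p⁻¹).toReal - (q⁻¹).toReal) := ⟨_, rfl⟩
  have he0 : 0 ≤ e := by linarith
  have he1 : p = 1 ∨ q = ⊤ → 0 < e := fun h => by linarith [hr' h]
  -- Both steps receive half of the excess `e`, so that each inequality is strict whenever its
  -- endpoint `p = 1` or `q = ∞` requires it.
  obtain ⟨r₁, hr₁⟩ : ∃ r₁, r₁ = (n : ℝ) * (1 / 2 - (q⁻¹).toReal) + e / 2 := ⟨_, rfl⟩
  obtain ⟨r₂, hr₂⟩ : ∃ r₂, r₂ = (n : ℝ) * ((p⁻¹).toReal - 1 / 2) + e / 2 := ⟨_, rfl⟩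
  have hrr : r₁ + r₂ = r := by rw [hr₁, hr₂, he]; ring
  have hr0 : 0 ≤ r := by
    have h1 : (q⁻¹).toReal ≤ (p⁻¹).toReal :=
      ENNReal.toReal_mono (ne_top_of_le_ne_top ENNReal.one_ne_top (ENNReal.inv_le_one.2 hp1.out))
        (ENNReal.inv_le_inv.2 (hp.trans hq))
    exact (mul_nonneg n.cast_nonneg (sub_nonneg.2 h1)).trans hr
  obtain ⟨C₁, hC₁, h₁⟩ := exists_eLpNorm_le_weighted hn hq (ρ := r₁) (by linarith)
    fun h => by linarith [he1 (Or.inr h)]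
  obtain ⟨C₂, hC₂, h₂⟩ := exists_smulLeftCLM_fourier_eq d hn hp (ρ := r₂) (by linarith)
    fun h => by linarith [he1 (Or.inl h)]
  obtain ⟨C₃, γ, hC₃, hγ, h₃⟩ := exists_ae_norm_sq_fourier_le hn hA hB hB1 hB3
  -- The rate is halved because the decay estimate bounds the square of the norm.
  obtain ⟨K, hK, hKw⟩ := exists_scaledWeight_mul_exp_le n hr0 (half_pos hγ)
  refine ⟨C₁ * (√C₃ * K) * C₂, by positivity, fun U₀ U hU₀ hU t ht => ?_⟩
  obtain ⟨g, hg⟩ := hU₀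
  rw [lprNorm_eq p r U₀ g hg]
  have hT : 1 ≤ 1 + t := by linarith
  obtain ⟨f, hf, hfn⟩ := h₂ g (1 + t) hT
  have hw := scaledWeight_hasTemperateGrowth (n := n) (T := 1 + t) (by linarith) (-(r₂ / 2))
  have hJ := japaneseSymbol_hasTemperateGrowth (n := n) r
  have hgF : 𝓕 (g : 𝓢'(Rn n, Cd d)) = smulLeftCLM (Cd d) (japaneseSymbol r)
      ((𝓕 (U 0) : Lp (Cd d) 2 (volume : Measure (Rn n))) : 𝓢'(Rn n, Cd d)) := by
    rw [← hg, japaneseOp, fourierMultiplierCLM_apply, fourier_fourierInv_eq, ← hU.initial,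
      Lp.fourier_toTemperedDistribution_eq]
  rw [hgF, smulLeftCLM_smulLeftCLM_apply hJ hw, mul_comm (japaneseSymbol r)] at hf
  have hfe := ae_eq_of_eq_smulLeftCLM (hw.mul hJ) hf
  have hbound : ∀ᵐ ξ : Rn n, ‖((1 + (1 + t) * ‖ξ‖ ^ 2) ^ (r₁ / 2) : ℝ) •
      (𝓕 (U t) : Lp (Cd d) 2 (volume : Measure (Rn n))) ξ‖ ≤ √C₃ * K * ‖f ξ‖ := by
    filter_upwards [h₃ U₀ U hU t ht, hfe] with ξ e1 e2
    obtain ⟨x, hx⟩ : ∃ x, x = ‖(𝓕 (U 0) : Lp (Cd d) 2 (volume : Measure (Rn n))) ξ‖ := ⟨_, rfl⟩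
    have hx0 : 0 ≤ x := hx ▸ norm_nonneg _
    have e3 : ‖(𝓕 (U t) : Lp (Cd d) 2 (volume : Measure (Rn n))) ξ‖ ≤
        √C₃ * Real.exp (-(γ / 2) * (‖ξ‖ ^ 2 / (1 + ‖ξ‖ ^ 2)) * t) * x := by
      refine le_of_sq_le_sq (e1.trans (le_of_eq ?_)) (by positivity)
      rw [hx, mul_pow, mul_pow, Real.sq_sqrt hC₃.le, ← Real.exp_nat_mul]
      congr 3
      push_cast
      ring
    have hw1 := scaledWeight_pos (n := n) (T := 1 + t) (by linarith) (r₁ / 2) ξ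
    have hw2 := scaledWeight_pos (n := n) (T := 1 + t) (by linarith) (-(r₂ / 2)) ξ
    have e4 : ‖f ξ‖ = scaledWeight (1 + t) (-(r₂ / 2)) ξ *
        (1 + (2 * Real.pi * ‖ξ‖) ^ 2) ^ (r / 2) * x := by
      rw [e2, norm_smul, hx, Pi.mul_apply, norm_mul, japaneseSymbol, Complex.norm_real,
        Complex.norm_real, Real.norm_of_nonneg hw2.le, Real.norm_of_nonneg (by positivity)]
    rw [norm_smul, e4]
    change ‖scaledWeight (1 + t) (r₁ / 2) ξ‖ * _ ≤ _
    rw [Real.norm_of_nonneg hw1.le]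
    have e5 := hKw r₁ r₂ hrr ξ t ht
    calc _ ≤ scaledWeight (1 + t) (r₁ / 2) ξ *
          (√C₃ * Real.exp (-(γ / 2) * (‖ξ‖ ^ 2 / (1 + ‖ξ‖ ^ 2)) * t) * x) := by gcongr
      _ = √C₃ * (scaledWeight (1 + t) (r₁ / 2) ξ *
          Real.exp (-(γ / 2) * (‖ξ‖ ^ 2 / (1 + ‖ξ‖ ^ 2)) * t)) * x := by ring
      _ ≤ √C₃ * (K * (scaledWeight (1 + t) (-(r₂ / 2)) ξ *
          (1 + (2 * Real.pi * ‖ξ‖) ^ 2) ^ (r / 2))) * x := by gcongr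
      _ = _ := by ring
  have hUt : (Lp.fourierTransformₗᵢ (Rn n) (Cd d)).symm.toLinearIsometry (𝓕 (U t)) = U t :=
    (Lp.fourierTransformₗᵢ (Rn n) (Cd d)).symm_apply_apply (U t)
  have h4 := h₁ (Lp.fourierTransformₗᵢ (Rn n) (Cd d)).symm.toLinearIsometry
    (fun f => eLpNorm_fourierInv_top_le f) (𝓕 (U t)) (1 + t) hT
  rw [hUt] at h4
  have h5 := eLpNorm_le_mul_eLpNorm_of_ae_le_mul hbound 2
  have h6 : eLpNorm f 2 volume ≤
      ENNReal.ofReal (C₂ * (1 + t) ^ (-((n : ℝ) / 2 * ((p⁻¹).toReal - 1 / 2)))) * ‖g‖ₑ := by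
    rw [← Lp.enorm_def, ← ofReal_norm, ← ofReal_norm, ← ENNReal.ofReal_mul (by positivity)]
    exact ENNReal.ofReal_le_ofReal hfn
  refine h4.trans ((mul_le_mul_right (h5.trans (mul_le_mul_right h6 _)) _).trans (le_of_eq ?_))
  rw [← mul_assoc, ← mul_assoc, ← ENNReal.ofReal_mul (by positivity),
    ← ENNReal.ofReal_mul (by positivity)]
  congr 2
  -- The gains of the two embeddings add up, as `(1/p - 1/2) + (1/2 - 1/q) = 1/p - 1/q`.
  have h7 : (1 + t) ^ (-((n : ℝ) / 2 * ((p⁻¹).toReal - (q⁻¹).toReal))) =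
      (1 + t) ^ (-((n : ℝ) / 2 * (1 / 2 - (q⁻¹).toReal))) *
        (1 + t) ^ (-((n : ℝ) / 2 * ((p⁻¹).toReal - 1 / 2))) := by
    rw [← Real.rpow_add (by linarith)]
    congr 1
    ring
  rw [h7]
  ring

end PartDiss
theorem mainTheorem8 {n d : ℕ} (hn : 0 < n) [NeZero d]
    (A : Fin n → ℝ → Matrix (Fin d) (Fin d) ℂ) (B : ℝ → Matrix (Fin d) (Fin d) ℂ)
    (hA : ∀ k, PartDiss.MatTClass 0 (A k)) (hB : PartDiss.MatTClass 0 B)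
    (hB1 : PartDiss.CondB1 A B) (hB2 : PartDiss.CondB2 B) (hB3 : PartDiss.CondB3 A B)
    (p q : ℝ≥0∞) [Fact (1 ≤ p)] (hp : p ≤ 2) (hq : 2 ≤ q)
    (r : ℝ) (hr : (n : ℝ) * ((p⁻¹).toReal - (q⁻¹).toReal) ≤ r)
    (hr' : p = 1 ∨ q = ⊤ → (n : ℝ) * ((p⁻¹).toReal - (q⁻¹).toReal) < r) :
    ∃ C : ℝ, 0 < C ∧
      ∀ (U₀ : 𝓢'(PartDiss.Rn n, PartDiss.Cd d))
        (U : ℝ → Lp (PartDiss.Cd d) 2 (volume : Measure (PartDiss.Rn n))),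
        PartDiss.MemLpr p r U₀ → PartDiss.IsSolution A B U₀ U →
        ∀ t : ℝ, 0 ≤ t →
          eLpNorm (U t) q volume ≤
            ENNReal.ofReal
                (C * (1 + t) ^ (-((n : ℝ) / 2 * ((p⁻¹).toReal - (q⁻¹).toReal)))) *
              PartDiss.lprNorm p r U₀ := by
  exact PartDiss.exists_eLpNorm_le_lprNorm hn hA hB hB1 hB3 hp hq hr hr'
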